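/- Let $U$ be a finite set of alternatives with $|U|\ge 5$, and let $\Delta$ be the set of probability measures on $U$ (outcomes), with the topology induced by $\mathbb R^U$; identify $a\in U$ with the point mass at $a$, and for $X\subseteq U$ let $\Delta_X$ be the set of outcomes with support in $X$. A preference relation $\succ$ is an asymmetric relation on $\Delta$; write $p\sim q$ if neither $p\succ q$ nor $q\succ p$, and $p\succsim q$ if $p\succ q$ or $p\sim q$. Let $\mathcal R$ be the set of all preference relations $\succ$ such that for every $p$ the sets $\{q: q\succ p\}$ and $\{q: p\succ q\}$ are open in $\Delta$ (continuity); $\{q: q\succ p\}$, $\{q: p\succ q\}$, $\{q: q\succsim p\}$ and $\{q: p\succsim q\}$ are convex (convexity); and for all $p,q,r\in\Delta$ and $\lambda\in(0,1)$, if $q\sim\frac12p+\frac12r$ and $\lambda p+(1-\lambda)r\sim\frac12p+\frac12q$, then $\lambda r+(1-\lambda)p\sim\frac12r+\frac12q$ (symmetry). An SSB function is a skew-symmetric $\phi:\Delta\times\Delta\to\mathbb R$ that is linear (with respect to convex combinations) in both arguments; $\phi$ represents $\succ$ if $p\succ q\iff\phi(p,q)>0$ for all $p,q\in\Delta$. It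 is normalized if its largest value is $1$ or if it is identically $0$. Let $\mathcal R^{\mathrm{PC}}$ be the set of relations in $\mathcal R$ represented by a normalized SSB function $\phi$ with $\phi(a,b)\in\{-1,0,1\}$ for all $a,b\in U$ (pairwise-comparison preferences). A domain $\mathcal D\subseteq\mathcal R$ is rich if: (i) for all ${\succ}\in\mathcal D$ and every permutation $\pi$ of $U$, the relation obtained from $\succ$ by renaming alternatives by $\pi$ is in $\mathcal D$; (ii) the empty relation (complete indifference) is in $\mathcal D$; (iii) the inverse of every relation in $\mathcal D$ is in $\mathcal D$; (iv) for all $\hat\succ\in\mathcal D$ and $X\subseteq U$ with $|X|\le 4$ there are ${\succ}\in\mathcal D$ and $a\in U$ such that $\succ$ and $\hat\succ$ agree on the pure outcomes in $X$, and $x\succ a$ for all $x\in X$. Let $N$ be a finite set of agents with $|N|\ge2$. A social welfare function (SWF) on $\mathcal D$ is a map $f:\mathcal D^N\to\mathcal R$. It is Pareto optimal if for all profiles $R=(\succ_i)_{i\in N}\in\mathcal D^N$ and $p,q\in\Delta$, with ${\succ}=f(R)$: if $p\succsim_i q$ for all $i$, then $p\succsim q$, and if moreover $p\succ_i q$ for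 some $i$, then $p\succ q$. It satisfies independence of irrelevant alternatives (IIA) if for all $R,\hat R\in\mathcal D^N$ and $X\subseteq U$, whenever the relations in $R$ and $\hat R$ coincide agent by agent on $\Delta_X$, then $f(R)$ and $f(\hat R)$ coincide on $\Delta_X$. Theorem. Let $\mathcal D\subseteq\mathcal R^{\mathrm{PC}}$ be a rich domain and let $f:\mathcal D^N\to\mathcal R$ be an SWF that satisfies Pareto optimality and IIA. Then $f$ is affine utilitarian with positive weights: there are $w_i>0$ $(i\in N)$ such that for all $R=(\succ_i)_{i\in N}\in\mathcal D^N$ and all normalized SSB functions $\phi_i$ representing $\succ_i$ $(i\in N)$, the relation $f(R)$ is represented by $\sum_{i\in N}w_i\phi_i$. -/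

import Mathlib

namespace ConvexAggregation

/-- Outcomes: probability measures on the finite set `U` of alternatives, with the topology
induced by `U → ℝ`. -/
abbrev Outcome (U : Type*) [Fintype U] : Type _ := stdSimplex ℝ U

/-- Binary relations on outcomes; `r p q` reads "`p` is strictly preferred to `q`". -/
abbrev Pref (U : Type*) [Fintype U] : Type _ := Outcome U → Outcome U → Prop

section Outcomes

variable {U : Type*} [Fintype U]

/-- The convex combination `t p + (1 - t) q`. -/
def mix (t : ℝ) (h0 : 0 ≤ t) (h1 : t ≤ 1) (p q : Outcome U) : Outcome U :=
  ⟨t • p.1 + (1 - t) • q.1,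
    convex_stdSimplex ℝ U p.2 q.2 h0 (by linarith) (by ring)⟩

/-- The midpoint `1/2 p + 1/2 q`. -/
noncomputable def mid (p q : Outcome U) : Outcome U :=
  mix (1 / 2) (by norm_num) (by norm_num) p q

/-- The pure outcome that assigns probability one to the alternative `a`. -/
def pureOutcome [DecidableEq U] (a : U) : Outcome U :=
  ⟨Pi.single a 1, single_mem_stdSimplex ℝ a⟩

/-- The outcomes with support in `X`. -/
def outcomesOn (X : Set U) : Set (Outcome U) :=
  {p | ∀ a, a ∉ X → p.1 a = 0}

/-- The outcome `p` with alternatives renamed by `π`: it gives `π a` the probability `p a`. -/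
def permOutcome (π : Equiv.Perm U) (p : Outcome U) : Outcome U :=
  ⟨fun a => p.1 (π.symm a), by
    exact ⟨fun a => p.2.1 (π.symm a), (Equiv.sum_comp π.symm p.1).trans p.2.2⟩⟩

end Outcomes

section Preferences

variable {U : Type*} [Fintype U]

/-- Indifference. -/
def Indiff (r : Pref U) (p q : Outcome U) : Prop := ¬ r p q ∧ ¬ r q p

/-- Weak preference. -/
def WeakPref (r : Pref U) (p q : Outcome U) : Prop := r p q ∨ Indiff r p q

/-- Strict upper contour set of `p`. -/
def upperSet (r : Pref U) (p : Outcome U) : Set (Outcome U) := {q | r q p}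

/-- Strict lower contour set of `p`. -/
def lowerSet (r : Pref U) (p : Outcome U) : Set (Outcome U) := {q | r p q}

/-- Indifference set of `p`. -/
def indiffSet (r : Pref U) (p : Outcome U) : Set (Outcome U) := {q | Indiff r p q}

/-- Convexity of a set of outcomes, as a subset of `U → ℝ`. -/
def ConvexOutcomes (S : Set (Outcome U)) : Prop :=
  Convex ℝ (Subtype.val '' S)

/-- Asymmetry, required of every preference relation. -/
def AsymmPref (r : Pref U) : Prop := ∀ p q, r p q → ¬ r q p

/-- Continuity: strict contour sets are open (in the simplex). -/
def ContinuousPref (r : Pref U) : Prop :=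
  ∀ p, IsOpen (upperSet r p) ∧ IsOpen (lowerSet r p)

/-- Convexity of strict and weak contour sets. -/
def ConvexPref (r : Pref U) : Prop :=
  ∀ p, ConvexOutcomes (upperSet r p) ∧ ConvexOutcomes (lowerSet r p) ∧
    ConvexOutcomes (upperSet r p ∪ indiffSet r p) ∧
    ConvexOutcomes (lowerSet r p ∪ indiffSet r p)

/-- Fishburn's symmetry axiom, for all triples of outcomes. -/
def SymmetricPref (r : Pref U) : Prop :=
  ∀ (p q s : Outcome U) (t : ℝ) (h0 : 0 < t) (h1 : t < 1),
    Indiff r q (mid p s) →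
    Indiff r (mix t h0.le h1.le p s) (mid p q) →
    Indiff r (mix t h0.le h1.le s p) (mid s q)

/-- All continuous, convex and symmetric preference relations. -/
def allPrefs (U : Type*) [Fintype U] : Set (Pref U) :=
  {r | AsymmPref r ∧ ContinuousPref r ∧ ConvexPref r ∧ SymmetricPref r}

end Preferences

section SSB

variable {U : Type*} [Fintype U]

/-- Skew-symmetric bilinear (SSB) functions on outcomes; linearity is with respect to convex
combinations. -/
structure IsSSB (φ : Outcome U → Outcome U → ℝ) : Prop where
  skew : ∀ p q, φ p q = - φ q p
  linear_left : ∀ (t : ℝ) (h0 : 0 ≤ t) (h1 : t ≤ 1) (p q s : Outcome U),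
    φ (mix t h0 h1 p q) s = t * φ p s + (1 - t) * φ q s
  linear_right : ∀ (t : ℝ) (h0 : 0 ≤ t) (h1 : t ≤ 1) (p q s : Outcome U),
    φ s (mix t h0 h1 p q) = t * φ s p + (1 - t) * φ s q

/-- The preference relation `r` is represented by `φ`. -/
def Represents (φ : Outcome U → Outcome U → ℝ) (r : Pref U) : Prop :=
  ∀ p q, r p q ↔ 0 < φ p q

/-- Normalized SSB functions: the largest value is `1`; complete indifference is represented by
the zero function. -/
def normalizedSSB (U : Type*) [Fintype U] : Set (Outcome U → Outcome U → ℝ) :=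
  {φ | IsSSB φ ∧
    ((∀ p q, φ p q = 0) ∨ IsGreatest {v : ℝ | ∃ p q, φ p q = v} 1)}

/-- Normalized SSB functions based on pairwise comparisons. -/
def pcSSB (U : Type*) [Fintype U] [DecidableEq U] : Set (Outcome U → Outcome U → ℝ) :=
  {φ | φ ∈ normalizedSSB U ∧ ∀ a b : U,
    φ (pureOutcome a) (pureOutcome b) = -1 ∨ φ (pureOutcome a) (pureOutcome b) = 0 ∨
      φ (pureOutcome a) (pureOutcome b) = 1}

/-- Pairwise-comparison (PC) preferences. -/
def pcPrefs (U : Type*) [Fintype U] [DecidableEq U] : Set (Pref U) :=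
  {r | r ∈ allPrefs U ∧ ∃ φ ∈ pcSSB U, Represents φ r}

end SSB

section Domains

variable {U : Type*} [Fintype U]

/-- The relation `r` with alternatives renamed by `π`:
`permPref π r (permOutcome π p) (permOutcome π q)` holds iff `r p q` does. -/
def permPref (π : Equiv.Perm U) (r : Pref U) : Pref U :=
  fun p q => r (permOutcome π.symm p) (permOutcome π.symm q)

/-- Rich domains of preference relations. -/
structure IsRich [DecidableEq U] (D : Set (Pref U)) : Prop where
  subset : D ⊆ allPrefs U
  /-- neutrality -/
  neutral : ∀ r ∈ D, ∀ π : Equiv.Perm U, permPref π r ∈ D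
  /-- complete indifference is allowed -/
  indifference : (fun _ _ => False) ∈ D
  /-- completely opposed preferences are allowed -/
  inverse : ∀ r ∈ D, (fun p q => r q p) ∈ D
  /-- up to four pure outcomes can be put above some further pure outcome -/
  bottom : ∀ r' ∈ D, ∀ X : Finset U, X.card ≤ 4 → ∃ r ∈ D, ∃ a : U,
    (∀ x ∈ X, ∀ y ∈ X, (r (pureOutcome x) (pureOutcome y) ↔
      r' (pureOutcome x) (pureOutcome y))) ∧
    ∀ x ∈ X, r (pureOutcome x) (pureOutcome a)

end Domains

section Aggregation

variable {U : Type*} [Fintype U] {N : Type*}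

/-- Social welfare functions on the domain `D` for the set `N` of agents. -/
abbrev SWF (N : Type*) {U : Type*} [Fintype U] (D : Set (Pref U)) : Type _ :=
  (N → D) → allPrefs U

variable {D : Set (Pref U)}

/-- Pareto optimality. -/
def ParetoOptimal (f : SWF N D) : Prop :=
  ∀ (R : N → D) (p q : Outcome U), (∀ i, WeakPref (R i : Pref U) p q) →
    WeakPref (f R : Pref U) p q ∧
      ((∃ i, (R i : Pref U) p q) → (f R : Pref U) p q)

/-- Equality of the restrictions of two relations to a set of outcomes. -/
def AgreeOn (S : Set (Outcome U)) (r r' : Pref U) : Prop :=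
  ∀ p ∈ S, ∀ q ∈ S, (r p q ↔ r' p q)

/-- Independence of irrelevant alternatives. -/
def IIA (f : SWF N D) : Prop :=
  ∀ (R R' : N → D) (X : Set U),
    (∀ i, AgreeOn (outcomesOn X) (R i : Pref U) (R' i : Pref U)) →
    AgreeOn (outcomesOn X) (f R : Pref U) (f R' : Pref U)

/-- Arrovian social welfare functions. -/
def Arrovian (f : SWF N D) : Prop := ParetoOptimal f ∧ IIA f

/-- The social welfare function `f` is affine utilitarian with weights `w`. -/
def AffineUtilitarianWith [Fintype N] (w : N → ℝ) (f : SWF N D) : Prop :=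
  ∀ (R : N → D) (φ : N → Outcome U → Outcome U → ℝ),
    (∀ i, φ i ∈ normalizedSSB U ∧ Represents (φ i) (R i : Pref U)) →
    Represents (fun p q => ∑ i, w i * φ i p q) (f R : Pref U)

end Aggregation

end ConvexAggregation

namespace ConvexAggregation

open Filter Topology

/-! The proof has two halves: a representation theorem that turns preferences into skew-symmetric
matrices, and an aggregation argument on those matrices.

Representation. Convexity and symmetry imply dominance (`rel_mix_of_rel_of_tie`): an indifference
set cannot stop partway along a segment that ends at a strictly worse or better point. Separation by
Hahn-Banach then describes the relation at a point by a linear functional (`exists_describesAt`),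
unique only up to a positive factor. Along a strict segment, scaled to unit increase in its
direction, these functionals are continuous and satisfy Jensen's equation locally by the symmetry
axiom, so they are affine in the parameter (`DescribesLine.affine`). This yields a cyclic product
identity for three comparable points (`triangle_identity`), which is what makes it possible to
choose all scales so that the functionals fit together into one skew-symmetric bilinear form
(`exists_skew_bilinear`). Forms with equal signs are proportional (`SameSign.proportional`). Hence
IIA says that individual comparisons on a set of alternatives determine the social matrix there up
to a positive factor, and a normalized representation of a pairwise-comparison preference is the
form of its comparison matrix.

Aggregation. Richness provides an alternative `b` that everyone puts below a given small set, and
the social intensity against `b` serves as the unit. Pareto indifference between suitable lotteries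
shows that this unit is the same for all alternatives above `b` (`bottom_eq`) and that the social
comparison of two alternatives, in this unit, depends only on the vector of individual comparisons.
This gives a function `g` on sign vectors (`exists_comparison`). Any linear relation between
individual comparisons that expresses a unanimous indifference between lotteries also holds for `g`
(`comparison_relation`). Three such relations make `g` odd-additive over disjoint groups of agents,
hence linear (`comparison_linear`), with positive coefficients by Pareto optimality. These
coefficients are the weights. The scale factors on sets of at most four alternatives agree because
any two pairs fit into one such set (`exists_weights`). -/

/-- Neither of the two points is related to the other. -/
def Tie {E : Type*} (r : E → E → Prop) (x y : E) : Prop := ¬ r x y ∧ ¬ r y x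

theorem Tie.symm {E : Type*} {r : E → E → Prop} {x y : E} (h : Tie r x y) : Tie r y x := ⟨h.2, h.1⟩

theorem tie_swap {E : Type*} {r : E → E → Prop} {x y : E} : Tie (fun x y => r y x) x y ↔ Tie r x y :=
  ⟨fun h => ⟨h.2, h.1⟩, fun h => ⟨h.2, h.1⟩⟩

/-! ### Convex, continuous, symmetric relations: behaviour on segments and dominance. -/

section VectorRelations

variable {E : Type*} [AddCommGroup E] [Module ℝ E] [TopologicalSpace E]

/-- A continuous, convex and symmetric asymmetric relation on a convex set of vectors. -/
structure IsConvexPref (C : Set E) (r : E → E → Prop) : Prop where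
  convex : Convex ℝ C
  asymm : ∀ x ∈ C, ∀ y ∈ C, r x y → ¬ r y x
  open_upper : ∀ p ∈ C, ∀ q ∈ C, r q p → ∀ᶠ x in 𝓝[C] q, r x p
  open_lower : ∀ p ∈ C, ∀ q ∈ C, r p q → ∀ᶠ x in 𝓝[C] q, r p x
  convex_upper : ∀ p ∈ C, Convex ℝ {q ∈ C | r q p}
  convex_lower : ∀ p ∈ C, Convex ℝ {q ∈ C | r p q}
  convex_weakUpper : ∀ p ∈ C, Convex ℝ {q ∈ C | ¬ r p q}
  convex_weakLower : ∀ p ∈ C, Convex ℝ {q ∈ C | ¬ r q p}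
  symm : ∀ p ∈ C, ∀ q ∈ C, ∀ s ∈ C, ∀ t : ℝ, 0 < t → t < 1 →
    Tie r q ((1 / 2 : ℝ) • p + (1 / 2 : ℝ) • s) →
    Tie r (t • p + (1 - t) • s) ((1 / 2 : ℝ) • p + (1 / 2 : ℝ) • q) →
    Tie r (t • s + (1 - t) • p) ((1 / 2 : ℝ) • s + (1 / 2 : ℝ) • q)

variable {C : Set E} {r : E → E → Prop}

namespace IsConvexPref

theorem swap (h : IsConvexPref C r) : IsConvexPref C (fun x y => r y x) where
  convex := h.convex
  asymm x hx y hy := h.asymm y hy x hx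
  open_upper := h.open_lower
  open_lower := h.open_upper
  convex_upper := h.convex_lower
  convex_lower := h.convex_upper
  convex_weakUpper := h.convex_weakLower
  convex_weakLower := h.convex_weakUpper
  symm p hp q hq s hs t h0 h1 h2 h3 :=
    tie_swap.2 (h.symm p hp q hq s hs t h0 h1 (tie_swap.1 h2) (tie_swap.1 h3))

theorem irrefl (h : IsConvexPref C r) {x : E} (hx : x ∈ C) : ¬ r x x :=
  fun h1 => h.asymm x hx x hx h1 h1

theorem tie_refl (h : IsConvexPref C r) {x : E} (hx : x ∈ C) : Tie r x x :=
  ⟨h.irrefl hx, h.irrefl hx⟩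

theorem tie_convex (h : IsConvexPref C r) {p : E} (hp : p ∈ C) :
    Convex ℝ {q ∈ C | Tie r p q} := by
  have : {q ∈ C | Tie r p q} = {q ∈ C | ¬ r p q} ∩ {q ∈ C | ¬ r q p} := by
    ext q; simp only [Set.mem_ofPred_eq, Set.mem_inter_iff, Tie]; tauto
  rw [this]
  exact (h.convex_weakUpper p hp).inter (h.convex_weakLower p hp)

theorem mem_line (h : IsConvexPref C r) {x y : E} (hx : x ∈ C) (hy : y ∈ C) {t : ℝ}
    (h0 : 0 ≤ t) (h1 : t ≤ 1) : (1 - t) • x + t • y ∈ C :=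
  h.convex hx hy (by linarith) h0 (by ring)

theorem tie_line (h : IsConvexPref C r) {p x y : E} (hp : p ∈ C) (hx : x ∈ C) (hy : y ∈ C)
    (hpx : Tie r p x) (hpy : Tie r p y) {t : ℝ} (h0 : 0 ≤ t) (h1 : t ≤ 1) :
    Tie r p ((1 - t) • x + t • y) :=
  (h.tie_convex hp ⟨hx, hpx⟩ ⟨hy, hpy⟩ (by linarith : (0 : ℝ) ≤ 1 - t) h0 (by ring)).2

/-- Two uses of the convexity of indifference sets: each end is tied with every point between, hence
so are any two points between. -/
theorem tie_segment (h : IsConvexPref C r) {p q : E} (hp : p ∈ C) (hq : q ∈ C)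
    (hpq : Tie r p q) {s t : ℝ} (h0 : 0 ≤ s) (h1 : s ≤ 1) (h2 : 0 ≤ t) (h3 : t ≤ 1) :
    Tie r ((1 - s) • p + s • q) ((1 - t) • p + t • q) := by
  have hx := h.mem_line hp hq h0 h1
  exact h.tie_line hx hp hq (h.tie_line hp hp hq (h.tie_refl hp) hpq h0 h1).symm
    (h.tie_line hq hp hq hpq.symm (h.tie_refl hq) h0 h1).symm h2 h3

section Topological

variable [ContinuousAdd E] [ContinuousSMul ℝ E]

theorem upper_near (h : IsConvexPref C r) {p q s : E} (hp : p ∈ C) (hq : q ∈ C) (hs : s ∈ C)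
    (hqp : r q p) : ∃ δ : ℝ, 0 < δ ∧ δ ≤ 1 ∧ ∀ t, 0 ≤ t → t ≤ δ →
      r ((1 - t) • q + t • s) p := by
  have hc : Tendsto (fun t : ℝ => (1 - t) • q + t • s) (𝓝[Set.Icc 0 1] 0) (𝓝[C] q) := by
    apply tendsto_nhdsWithin_of_tendsto_nhds_of_eventually_within
    · have : Continuous (fun t : ℝ => (1 - t) • q + t • s) := by fun_prop
      have h2 := this.tendsto 0
      simp only [sub_zero, one_smul, zero_smul, add_zero] at h2
      exact h2.mono_left nhdsWithin_le_nhds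
    · filter_upwards [self_mem_nhdsWithin] with t ht
      exact h.mem_line hq hs ht.1 ht.2
  have he := hc.eventually (h.open_upper p hp q hq hqp)
  rw [eventually_nhdsWithin_iff, Metric.eventually_nhds_iff] at he
  obtain ⟨ε, hε, he⟩ := he
  refine ⟨min (ε / 2) 1, by positivity, min_le_right _ _, fun t h0 h1 => he ?_ ⟨h0, ?_⟩⟩
  · rw [Real.dist_eq, sub_zero, abs_of_nonneg h0]
    have := min_le_left (ε / 2) 1
    linarith
  · exact h1.trans (min_le_right _ _)

theorem lower_near (h : IsConvexPref C r) {p q s : E} (hp : p ∈ C) (hq : q ∈ C) (hs : s ∈ C)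
    (hpq : r p q) : ∃ δ : ℝ, 0 < δ ∧ δ ≤ 1 ∧ ∀ t, 0 ≤ t → t ≤ δ →
      r p ((1 - t) • q + t • s) :=
  h.swap.upper_near hp hq hs hpq

theorem tie_limit (h : IsConvexPref C r) {p q s : E} (hp : p ∈ C) (hq : q ∈ C) (hs : s ∈ C)
    {δ : ℝ} (hδ : 0 < δ) (ht : ∀ t, 0 < t → t ≤ δ → Tie r p ((1 - t) • q + t • s)) :
    Tie r p q := by
  constructor
  · intro h1
    obtain ⟨ε, h2, -, h4⟩ := h.lower_near hp hq hs h1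
    exact (ht (min ε δ) (by positivity) (min_le_right _ _)).1
      (h4 _ (by positivity) (min_le_left _ _))
  · intro h1
    obtain ⟨ε, h2, -, h4⟩ := h.upper_near hp hq hs h1
    exact (ht (min ε δ) (by positivity) (min_le_right _ _)).2
      (h4 _ (by positivity) (min_le_left _ _))

/-- Symmetry is applied with `q = s`. Points between `s` and the midpoint are tied with the
midpoint, and their mirror images, which lie near `p`, are then tied with `s`; continuity gives the
tie at `p`. -/
theorem tie_of_tie_midpoint (h : IsConvexPref C r) {p s : E} (hp : p ∈ C) (hs : s ∈ C)
    (hm : Tie r s ((1 / 2 : ℝ) • p + (1 / 2 : ℝ) • s)) : Tie r s p := by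
  have hmC : (1 / 2 : ℝ) • p + (1 / 2 : ℝ) • s ∈ C :=
    h.convex hp hs (by norm_num) (by norm_num) (by norm_num)
  refine h.tie_limit hs hp hs (δ := 1 / 2) (by norm_num) fun t h0 h1 => ?_
  have key := h.symm p hp s hs s hs t h0 (by linarith) hm ?_
  · have e1 : (1 / 2 : ℝ) • s + (1 / 2 : ℝ) • s = s := by module
    rw [e1] at key
    have e2 : (1 - t) • p + t • s = t • s + (1 - t) • p := by module
    rw [e2]; exact key.symm
  · have := h.tie_line hmC hs hmC hm.symm (h.tie_refl hmC) (t := 2 * t) (by linarith)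
      (by linarith)
    have e3 : t • p + (1 - t) • s = (1 - 2 * t) • s + (2 * t) •
      ((1 / 2 : ℝ) • p + (1 / 2 : ℝ) • s) := by module
    rw [e3]
    exact this.symm

theorem rel_midpoint_left (h : IsConvexPref C r) {p s : E} (hp : p ∈ C) (hs : s ∈ C)
    (hps : r p s) : r p ((1 / 2 : ℝ) • p + (1 / 2 : ℝ) • s) := by
  by_contra hn
  have h1 : ((1 / 2 : ℝ) • p + (1 / 2 : ℝ) • s) ∈ {q ∈ C | ¬ r q p} :=
    h.convex_weakLower p hp ⟨hp, h.irrefl hp⟩ ⟨hs, h.asymm p hp s hs hps⟩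
      (by norm_num) (by norm_num) (by norm_num)
  have h2 : Tie r p s := h.tie_of_tie_midpoint hs hp (by rw [add_comm]; exact ⟨hn, h1.2⟩)
  exact h2.1 hps

/-- A strictly preferred end point of a segment is preferred to all other points of it. -/
theorem rel_line_left (h : IsConvexPref C r) {p s : E} (hp : p ∈ C) (hs : s ∈ C)
    (hps : r p s) {t : ℝ} (h0 : 0 < t) (h1 : t ≤ 1) : r p ((1 - t) • p + t • s) := by
  -- Repeated halving gives strict preference over points arbitrarily close to `p`; convexity of the
  -- lower contour set fills in the rest of the segment.
  have hpow : ∀ k : ℕ, r p ((1 - (1 / 2 : ℝ) ^ k) • p + ((1 / 2 : ℝ) ^ k) • s) := by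
    intro k
    induction k with
    | zero => simpa using hps
    | succ k ih =>
      have hk : (1 / 2 : ℝ) ^ k ≤ 1 := pow_le_one₀ (by norm_num) (by norm_num)
      have := h.rel_midpoint_left hp (h.mem_line hp hs (by positivity) hk) ih
      convert this using 1
      rw [pow_succ]; module
  obtain ⟨k, hk⟩ := exists_pow_lt_of_lt_one h0 (by norm_num : (1 / 2 : ℝ) < 1)
  have hk1 : (1 / 2 : ℝ) ^ k ≤ 1 := pow_le_one₀ (by norm_num) (by norm_num)
  have hc := h.convex_lower p hp
  rcases eq_or_lt_of_le hk1 with he | hlt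
  · exact absurd hk (by rw [he]; linarith)
  set κ := (1 / 2 : ℝ) ^ k
  have h3 := (hc ⟨h.mem_line hp hs (by positivity) hk1, hpow k⟩ ⟨hs, hps⟩
    (a := (1 - t) / (1 - κ)) (b := (t - κ) / (1 - κ)) (div_nonneg (by linarith) (by linarith))
    (div_nonneg (by linarith) (by linarith)) (by field_simp; ring)).2
  have hne : 1 - κ ≠ 0 := by linarith
  have e : (1 - t) • p + t • s = ((1 - t) / (1 - κ)) • ((1 - κ) • p + κ • s) +
      ((t - κ) / (1 - κ)) • s := by
    match_scalars <;> field_simp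
    ring
  rw [e]; exact h3

theorem rel_line_right (h : IsConvexPref C r) {p s : E} (hp : p ∈ C) (hs : s ∈ C)
    (hps : r p s) {t : ℝ} (h0 : 0 ≤ t) (h1 : t < 1) : r ((1 - t) • p + t • s) s := by
  have := h.swap.rel_line_left hs hp hps (t := 1 - t) (by linarith) (by linarith)
  convert this using 1
  module

/-- This is the core of dominance: a tie on `[c, x]` cannot turn into strict preference beyond `x`
at the mirror image `a` of `c`. Symmetry copies a tie near `c` to a tie near `a`, where continuity
and convexity force strict preference. -/
theorem not_tie_tie_rel (h : IsConvexPref C r) {p a c : E} (hp : p ∈ C) (ha : a ∈ C)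
    (hc : c ∈ C) (hpc : Tie r p c)
    (hpx : Tie r p ((1 / 2 : ℝ) • c + (1 / 2 : ℝ) • a)) : ¬ r p a := by
  intro hpa
  set x := (1 / 2 : ℝ) • c + (1 / 2 : ℝ) • a with hx
  have hxC : x ∈ C := h.convex hc ha (by norm_num) (by norm_num) (by norm_num)
  have hnC : (1 / 2 : ℝ) • a + (1 / 2 : ℝ) • p ∈ C :=
    h.convex ha hp (by norm_num) (by norm_num) (by norm_num)
  -- Symmetry for the triple `c`, `b`, `a`, where `b` is `p` moved slightly towards `x` and is
  -- therefore still tied with the midpoint `x` of `c` and `a`.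
  have mirror : ∀ ε : ℝ, 0 < ε → ε < 1 →
      Tie r ((1 - ε / (2 + 2 * ε)) • a + (ε / (2 + 2 * ε)) • c)
        ((1 / 2 : ℝ) • a + (1 / 2 : ℝ) • ((1 - ε) • p + ε • x)) := by
    intro ε h0 h1
    have hbx : Tie r ((1 - ε) • p + ε • x) x := by
      have := h.tie_segment hp hxC hpx h0.le h1.le zero_le_one le_rfl
      simpa using this
    have hbC := h.mem_line hp hxC h0.le h1.le
    set b := (1 - ε) • p + ε • x with hb
    have hd : (0 : ℝ) < 2 + 2 * ε := by linarith
    have hle : 2 * ε / (2 + 2 * ε) ≤ 1 := by rw [div_le_one hd]; linarith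
    -- The weight is chosen so that the line from `p` through the midpoint of `c` and `b` meets `[c,
    -- x]` in `z`; this is the tie that symmetry requires.
    have hpz := h.tie_line hp hc hxC hpc hpx (t := 2 * ε / (2 + 2 * ε)) (by positivity) hle
    have hzC := h.mem_line hc hxC (t := 2 * ε / (2 + 2 * ε)) (by positivity) hle
    set z := (1 - 2 * ε / (2 + 2 * ε)) • c + (2 * ε / (2 + 2 * ε)) • x with hz
    have hzm := h.tie_segment hp hzC hpz zero_le_one le_rfl (t := (1 + ε) / 2)
      (by linarith) (by linarith)
    have e1 : (1 - (1 + ε) / 2) • p + ((1 + ε) / 2) • z =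
        (1 / 2 : ℝ) • c + (1 / 2 : ℝ) • b := by
      rw [hz, hb, hx]
      match_scalars <;> field_simp <;> ring
    have e2 : (1 - (1 : ℝ)) • p + (1 : ℝ) • z =
        (1 - ε / (2 + 2 * ε)) • c + (1 - (1 - ε / (2 + 2 * ε))) • a := by
      rw [hz, hx]
      match_scalars <;> field_simp <;> ring
    rw [e1, e2] at hzm
    have hlt : ε / (2 + 2 * ε) < 1 := by rw [div_lt_one hd]; linarith
    have := h.symm c hc b hbC a ha (1 - ε / (2 + 2 * ε)) (by linarith)
      (by have : 0 < ε / (2 + 2 * ε) := by positivity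
          linarith) hbx hzm
    convert this using 2
    ring_nf
  have hna : r ((1 / 2 : ℝ) • a + (1 / 2 : ℝ) • p) a := by
    have := h.rel_line_right hp ha hpa (t := 1 / 2) (by norm_num) (by norm_num)
    convert this using 1
    module
  set n := (1 / 2 : ℝ) • a + (1 / 2 : ℝ) • p with hn
  obtain ⟨η, hη0, hη1, hη⟩ := h.lower_near hnC ha hc hna
  have ha'C := h.mem_line ha hc hη0.le hη1
  have hna' := hη η hη0.le le_rfl
  set a' := (1 - η) • a + η • c with ha'
  have hsC : (1 / 2 : ℝ) • a + (1 / 2 : ℝ) • x ∈ C :=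
    h.convex ha hxC (by norm_num) (by norm_num) (by norm_num)
  obtain ⟨δ, hδ0, hδ1, hδ⟩ := h.upper_near ha hnC hsC hna
  obtain ⟨δ', hδ0', hδ1', hδ'⟩ := h.upper_near ha'C hnC hsC hna'
  have hε0 : 0 < min η (min δ δ') / 2 := by positivity
  have hεη : min η (min δ δ') ≤ η := min_le_left _ _
  have hεδ : min η (min δ δ') ≤ δ := (min_le_right _ _).trans (min_le_left _ _)
  have hεδ' : min η (min δ δ') ≤ δ' := (min_le_right _ _).trans (min_le_right _ _)
  set ε := min η (min δ δ') / 2 with hε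
  have h1 := hδ ε hε0.le (by linarith)
  have h2 := hδ' ε hε0.le (by linarith)
  have hyC := h.mem_line hnC hsC hε0.le (by linarith : ε ≤ 1)
  have hm := mirror ε hε0 (by linarith)
  have e3 : (1 / 2 : ℝ) • a + (1 / 2 : ℝ) • ((1 - ε) • p + ε • x) =
      (1 - ε) • n + ε • ((1 / 2 : ℝ) • a + (1 / 2 : ℝ) • x) := by
    rw [hn]; module
  rw [e3] at hm
  set y := (1 - ε) • n + ε • ((1 / 2 : ℝ) • a + (1 / 2 : ℝ) • x)
  set θ := ε / (2 + 2 * ε) with hθ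
  have hθ0 : 0 ≤ θ := by positivity
  have hθη : θ ≤ η := by
    rw [hθ, div_le_iff₀ (by linarith)]
    nlinarith
  -- The mirrored point lies between `a` and `a'` since `θ ≤ η`, and `y` beats both, against the tie
  -- given by `mirror`.
  have h3 := (h.convex_lower y hyC ⟨ha, h1⟩ ⟨ha'C, h2⟩ (a := 1 - θ / η) (b := θ / η)
    (by rw [sub_nonneg, div_le_one hη0]; exact hθη) (by positivity) (by ring)).2
  have e4 : (1 - θ / η) • a + (θ / η) • a' = (1 - θ) • a + θ • c := by
    rw [ha']
    match_scalars <;> field_simp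
    ring
  rw [e4] at h3
  exact hm.2 h3

/-- Dominance: mixtures of a worse and an indifferent point are worse. -/
theorem rel_mix_of_rel_of_tie (h : IsConvexPref C r) {p q s : E} (hp : p ∈ C) (hq : q ∈ C)
    (hs : s ∈ C) (hpq : r p q) (hps : Tie r p s) {t : ℝ} (h0 : 0 < t) (h1 : t ≤ 1) :
    r p ((1 - t) • s + t • q) := by
  by_contra hn
  have hweak : ∀ t : ℝ, 0 ≤ t → t ≤ 1 → ¬ r ((1 - t) • s + t • q) p := fun t h0 h1 =>
    (h.convex_weakLower p hp ⟨hs, hps.2⟩ ⟨hq, h.asymm p hp q hq hpq⟩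
      (by linarith : (0 : ℝ) ≤ 1 - t) h0 (by ring)).2
  -- `τ` is the last parameter at which the point is tied with `p`. Equal steps `δ` to both sides of
  -- `τ` give a configuration excluded by `not_tie_tie_rel`.
  set T : Set ℝ := {t | t ∈ Set.Icc (0 : ℝ) 1 ∧ ¬ r p ((1 - t) • s + t • q)} with hT
  have htT : t ∈ T := ⟨⟨h0.le, h1⟩, hn⟩
  have hbdd : BddAbove T := ⟨1, fun u hu => hu.1.2⟩
  set τ := sSup T with hτ
  have htτ : t ≤ τ := le_csSup hbdd htT
  have hτ1 : τ ≤ 1 := csSup_le ⟨t, htT⟩ fun u hu => hu.1.2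
  have hbelow : ∀ u, 0 ≤ u → u < τ → Tie r p ((1 - u) • s + u • q) := by
    intro u hu0 hu
    obtain ⟨w, hw, huw⟩ := exists_lt_of_lt_csSup ⟨t, htT⟩ hu
    have hw0 : 0 < w := by linarith
    have hwT : Tie r p ((1 - w) • s + w • q) := ⟨hw.2, hweak w hw.1.1 hw.1.2⟩
    have := h.tie_line hp hs (h.mem_line hs hq hw.1.1 hw.1.2) hps hwT (t := u / w)
      (by positivity) (by rw [div_le_one hw0]; exact huw.le)
    convert this using 1
    match_scalars <;> field_simp
    ring
  have hxC := h.mem_line hs hq (h0.le.trans htτ) hτ1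
  have hxT : Tie r p ((1 - τ) • s + τ • q) := by
    refine h.tie_limit hp hxC hs (δ := 1) one_pos fun u hu0 hu1 => ?_
    have h3 : (1 - u) * τ < τ := by nlinarith
    have := hbelow ((1 - u) * τ) (mul_nonneg (by linarith) (by linarith)) h3
    convert this using 1
    module
  have hτlt : τ < 1 := by
    refine lt_of_le_of_ne hτ1 fun he => hxT.1 ?_
    rw [he]; simpa using hpq
  have hδ0 : 0 < min τ (1 - τ) := lt_min (by linarith) (by linarith)
  have hδ1 := min_le_left τ (1 - τ)
  have hδ2 := min_le_right τ (1 - τ)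
  set δ := min τ (1 - τ)
  have haC := h.mem_line hs hq (t := τ + δ) (by linarith) (by linarith)
  have hcC := h.mem_line hs hq (t := τ - δ) (by linarith) (by linarith)
  refine h.not_tie_tie_rel hp haC hcC (hbelow _ (by linarith) (by linarith)) ?_ ?_
  · convert hxT using 1
    module
  · by_contra hna
    have : τ + δ ∈ T := ⟨⟨by linarith, by linarith⟩, hna⟩
    have := le_csSup hbdd this
    linarith

theorem mix_rel_of_rel_of_tie (h : IsConvexPref C r) {p q s : E} (hp : p ∈ C) (hq : q ∈ C)
    (hs : s ∈ C) (hqp : r q p) (hps : Tie r p s) {t : ℝ} (h0 : 0 < t) (h1 : t ≤ 1) :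
    r ((1 - t) • s + t • q) p :=
  h.swap.rel_mix_of_rel_of_tie hp hq hs hqp (tie_swap.2 hps) h0 h1

/-- Between a better and a worse point there is an indifferent one. -/
theorem exists_tie_between (h : IsConvexPref C r) {p u l : E} (hp : p ∈ C) (hu : u ∈ C)
    (hl : l ∈ C) (hup : r u p) (hpl : r p l) :
    ∃ t : ℝ, 0 < t ∧ t < 1 ∧ Tie r p ((1 - t) • l + t • u) := by
  set T : Set ℝ := {t | t ∈ Set.Icc (0 : ℝ) 1 ∧ r p ((1 - t) • l + t • u)} with hT
  have h0T : (0 : ℝ) ∈ T := ⟨⟨le_rfl, zero_le_one⟩, by simpa using hpl⟩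
  have hbdd : BddAbove T := ⟨1, fun u hu => hu.1.2⟩
  set τ := sSup T with hτ
  have h0τ : 0 ≤ τ := le_csSup hbdd h0T
  have hτ1 : τ ≤ 1 := csSup_le ⟨0, h0T⟩ fun u hu => hu.1.2
  have hxC := h.mem_line hl hu h0τ hτ1
  have hT2 : ¬ r p ((1 - τ) • l + τ • u) := by
    intro h1
    obtain ⟨δ, hd0, hd1, hd⟩ := h.lower_near hp hxC hu h1
    have h2 := hd δ hd0.le le_rfl
    have h3 : τ + δ * (1 - τ) ∈ T := by
      refine ⟨⟨by nlinarith, by nlinarith⟩, ?_⟩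
      convert h2 using 1
      module
    have h4 := le_csSup hbdd h3
    have h5 : τ = 1 := by nlinarith
    rw [h5] at h1
    exact h.asymm p hp u hu (by simpa using h1) hup
  have hτ0 : 0 < τ := by
    refine lt_of_le_of_ne h0τ fun he => hT2 ?_
    rw [← he]; simpa using hpl
  have hT3 : ¬ r ((1 - τ) • l + τ • u) p := by
    intro h1
    obtain ⟨δ, hd0, hd1, hd⟩ := h.upper_near hp hxC hl h1
    obtain ⟨w, hw, hw1⟩ := exists_lt_of_lt_csSup ⟨0, h0T⟩ (by nlinarith : (1 - δ) * τ < τ)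
    have hwτ := le_csSup hbdd hw
    have h2 := hd (1 - w / τ) (by rw [sub_nonneg, div_le_one hτ0]; exact hwτ)
      (by rw [sub_le_comm, le_div_iff₀ hτ0]; exact hw1.le)
    refine h.asymm _ hp _ (h.mem_line hl hu hw.1.1 hw.1.2) hw.2 ?_
    convert h2 using 1
    match_scalars <;> field_simp <;> ring
  refine ⟨τ, hτ0, lt_of_le_of_ne hτ1 fun he => hT3 ?_, hT2, hT3⟩
  rw [he]; simpa using hup

end Topological

end IsConvexPref

end VectorRelations

/-! ### Linear functionals describing a relation at a point. -/

section Functionals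

variable {U : Type*} [Fintype U]

/-- Full-support outcomes. -/
def posSimplex (U : Type*) [Fintype U] : Set (U → ℝ) := {x ∈ stdSimplex ℝ U | ∀ a, 0 < x a}

theorem posSimplex_line {x y : U → ℝ} (hx : x ∈ stdSimplex ℝ U) (hy : y ∈ posSimplex U) {t : ℝ}
    (h0 : 0 < t) (h1 : t ≤ 1) : (1 - t) • x + t • y ∈ posSimplex U := by
  refine ⟨convex_stdSimplex ℝ U hx hy.1 (by linarith) h0.le (by ring), fun a => ?_⟩
  have h2 := hx.1 a
  have h3 := mul_pos h0 (hy.2 a)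
  have h4 := mul_nonneg (by linarith : 0 ≤ 1 - t) h2
  simpa using by linarith

theorem posSimplex_convex : Convex ℝ (posSimplex U) := by
  intro x hx y hy a b ha hb hab
  rcases eq_or_lt_of_le hb with rfl | hb
  · have : a = 1 := by linarith
    subst this; simpa using hx
  · have : a = 1 - b := by linarith
    subst this
    exact posSimplex_line hx.1 hy hb (by linarith)

theorem posSimplex_nonempty [Nonempty U] : (posSimplex U).Nonempty := by
  refine ⟨fun _ => (Fintype.card U : ℝ)⁻¹, ⟨fun a => by positivity, ?_⟩, fun a => by positivity⟩
  simp

/-- Full-support outcomes can be moved a little in every direction of the hyperplane. -/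
theorem posSimplex_move {z v : U → ℝ} (hz : z ∈ posSimplex U) (hv : ∑ a, v a = 0) :
    ∃ β : ℝ, 0 < β ∧ ∀ t : ℝ, |t| ≤ β → z + t • v ∈ posSimplex U := by
  have hev : ∀ᶠ t : ℝ in 𝓝 0, ∀ a, 0 < z a + t * v a := by
    rw [Filter.eventually_all]
    intro a
    have : Continuous (fun t : ℝ => z a + t * v a) := by fun_prop
    exact (this.tendsto 0).eventually (lt_mem_nhds (by simpa using hz.2 a))
  rw [Metric.eventually_nhds_iff] at hev
  obtain ⟨ε, hε, he⟩ := hev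
  refine ⟨ε / 2, by positivity, fun t ht => ?_⟩
  have hpos := he (y := t) (by rw [Real.dist_eq, sub_zero]; linarith)
  refine ⟨⟨fun a => ?_, ?_⟩, fun a => ?_⟩
  · simpa using (hpos a).le
  · have := hz.1.2
    simp [Finset.sum_add_distrib, ← Finset.mul_sum, hv, this]
  · simpa using hpos a

/-- The linear functional `L` describes the relation `r` at `p`. -/
def DescribesAt (r : (U → ℝ) → (U → ℝ) → Prop) (p : U → ℝ) (L : (U → ℝ) →ₗ[ℝ] ℝ) : Prop :=
  ∀ q ∈ stdSimplex ℝ U, (r q p ↔ 0 < L q) ∧ (r p q ↔ L q < 0)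

variable {r : (U → ℝ) → (U → ℝ) → Prop} {p : U → ℝ} {L : (U → ℝ) →ₗ[ℝ] ℝ}

theorem DescribesAt.tie_iff (hL : DescribesAt r p L) {q : U → ℝ} (hq : q ∈ stdSimplex ℝ U) :
    Tie r p q ↔ L q = 0 := by
  rw [Tie, (hL q hq).1, (hL q hq).2]
  constructor
  · rintro ⟨h1, h2⟩; linarith
  · intro h; rw [h]; simp

theorem DescribesAt.smul (hL : DescribesAt r p L) {c : ℝ} (hc : 0 < c) :
    DescribesAt r p (c • L) := by
  intro q hq
  rw [(hL q hq).1, (hL q hq).2]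
  simp only [LinearMap.smul_apply, smul_eq_mul, mul_pos_iff_of_pos_left hc, true_and]
  constructor
  · intro h; nlinarith
  · intro h; by_contra hn; nlinarith [not_lt.1 hn, mul_nonneg hc.le (not_lt.1 hn)]

namespace IsConvexPref

theorem normalize_mem {x : U → ℝ} [Nonempty U] (hx : ∀ a, 0 < x a) :
    (∑ a, x a)⁻¹ • x ∈ posSimplex U := by
  have hs : 0 < ∑ a, x a := Finset.sum_pos (fun a _ => hx a) Finset.univ_nonempty
  refine ⟨⟨fun a => ?_, ?_⟩, fun a => ?_⟩
  · have := hx a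
    simp only [Pi.smul_apply, smul_eq_mul]; positivity
  · simp only [Pi.smul_apply, smul_eq_mul, ← Finset.mul_sum]
    exact inv_mul_cancel₀ hs.ne'
  · have := hx a
    simp only [Pi.smul_apply, smul_eq_mul]; positivity

/-- The open cone over the full-support points that are strictly preferred to `p`. -/
def upperCone (r : (U → ℝ) → (U → ℝ) → Prop) (p : U → ℝ) : Set (U → ℝ) :=
  {x | (∀ a, 0 < x a) ∧ r ((∑ a, x a)⁻¹ • x) p}

theorem isOpen_upperCone [Nonempty U] (h : IsConvexPref (stdSimplex ℝ U) r)
    (hp : p ∈ stdSimplex ℝ U) : IsOpen (upperCone r p) := by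
  rw [isOpen_iff_mem_nhds]
  intro x hx
  have hs : 0 < ∑ a, x a := Finset.sum_pos (fun a _ => hx.1 a) Finset.univ_nonempty
  have hpos : ∀ᶠ y : U → ℝ in 𝓝 x, ∀ a, 0 < y a := by
    rw [Filter.eventually_all]
    intro a
    exact ((continuous_apply a).tendsto x).eventually (lt_mem_nhds (hx.1 a))
  have hc : Tendsto (fun y : U → ℝ => (∑ a, y a)⁻¹ • y) (𝓝 x)
      (𝓝[stdSimplex ℝ U] ((∑ a, x a)⁻¹ • x)) := by
    apply tendsto_nhdsWithin_of_tendsto_nhds_of_eventually_within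
    · have h1 : ContinuousAt (fun y : U → ℝ => ∑ a, y a) x := by fun_prop
      exact (h1.inv₀ hs.ne').smul continuousAt_id
    · filter_upwards [hpos] with y hy
      exact (normalize_mem hy).1
  filter_upwards [hpos, hc.eventually (h.open_upper p hp _ (normalize_mem hx.1).1 hx.2)]
    with y h1 h2 using ⟨h1, h2⟩

theorem convex_upperCone [Nonempty U] (h : IsConvexPref (stdSimplex ℝ U) r)
    (hp : p ∈ stdSimplex ℝ U) : Convex ℝ (upperCone r p) := by
  rw [convex_iff_forall_pos]
  intro x hx y hy a b ha hb hab
  have hsx : 0 < ∑ a, x a := Finset.sum_pos (fun a _ => hx.1 a) Finset.univ_nonempty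
  have hsy : 0 < ∑ a, y a := Finset.sum_pos (fun a _ => hy.1 a) Finset.univ_nonempty
  have hsum : ∑ i, (a • x + b • y) i = a * ∑ i, x i + b * ∑ i, y i := by
    simp [Finset.sum_add_distrib, Finset.mul_sum]
  refine ⟨fun i => ?_, ?_⟩
  · have h1 := hx.1 i
    have h2 := hy.1 i
    simp only [Pi.add_apply, Pi.smul_apply, smul_eq_mul]; positivity
  · rw [hsum]
    set X := ∑ i, x i
    set Y := ∑ i, y i
    have hd : 0 < a * X + b * Y := by positivity
    have := (h.convex_upper p hp ⟨(normalize_mem hx.1).1, hx.2⟩ ⟨(normalize_mem hy.1).1, hy.2⟩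
      (a := a * X / (a * X + b * Y)) (b := b * Y / (a * X + b * Y)) (by positivity)
      (by positivity) (by field_simp)).2
    change r ((a * X / (a * X + b * Y)) • X⁻¹ • x + (b * Y / (a * X + b * Y)) • Y⁻¹ • y) p at this
    convert this using 1
    match_scalars <;> field_simp

theorem smul_mem_upperCone {x : U → ℝ} (hx : x ∈ upperCone r p) {c : ℝ} (hc : 0 < c) :
    c • x ∈ upperCone r p := by
  refine ⟨fun a => ?_, ?_⟩
  · have := hx.1 a
    simp only [Pi.smul_apply, smul_eq_mul]; positivity
  · have h2 := hx.2
    convert h2 using 1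
    simp only [Pi.smul_apply, smul_eq_mul, ← Finset.mul_sum, smul_smul, mul_inv]
    congr 1
    field_simp

theorem mem_upperCone {x : U → ℝ} (hx : x ∈ posSimplex U) (hr : r x p) : x ∈ upperCone r p := by
  refine ⟨hx.2, ?_⟩
  rw [hx.1.2]; simpa using hr

theorem exists_pos_upper [Nonempty U] (h : IsConvexPref (stdSimplex ℝ U) r)
    (hp : p ∈ stdSimplex ℝ U) {u : U → ℝ} (hu : u ∈ stdSimplex ℝ U) (hup : r u p) :
    ∃ u ∈ posSimplex U, r u p := by
  obtain ⟨w, hw⟩ := posSimplex_nonempty (U := U)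
  obtain ⟨δ, h0, h1, h2⟩ := h.upper_near hp hu hw.1 hup
  exact ⟨_, posSimplex_line hu hw h0 h1, h2 δ h0.le le_rfl⟩

/-- A point with better and worse points is described by a linear functional. -/
theorem exists_describesAt (h : IsConvexPref (stdSimplex ℝ U) r) (hp : p ∈ stdSimplex ℝ U)
    (hu : ∃ u ∈ stdSimplex ℝ U, r u p) (hl : ∃ l ∈ stdSimplex ℝ U, r p l) :
    ∃ L : (U → ℝ) →ₗ[ℝ] ℝ, DescribesAt r p L := by
  have hne : Nonempty U := by
    by_contra hne
    rw [not_nonempty_iff] at hne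
    have := hp.2
    simp at this
  obtain ⟨u', hu', hup'⟩ := hu
  obtain ⟨l', hl', hpl'⟩ := hl
  obtain ⟨u, hu, hup⟩ := h.exists_pos_upper hp hu' hup'
  obtain ⟨l, hl, hpl⟩ := h.swap.exists_pos_upper hp hl' hpl'
  have hdisj : Disjoint (upperCone (fun x y => r y x) p) (upperCone r p) := by
    rw [Set.disjoint_left]
    intro x h1 h2
    exact h.asymm _ (normalize_mem h1.1).1 _ hp h2.2 h1.2
  -- Restriction to full-support points makes both cones open in the whole space, so that they can
  -- be separated strictly.
  obtain ⟨f, c, hlo, hup2⟩ := geometric_hahn_banach_open_open (h.swap.convex_upperCone hp)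
    (h.swap.isOpen_upperCone hp) (h.convex_upperCone hp) (h.isOpen_upperCone hp) hdisj
  have hscale : ∀ (g d : ℝ), (∀ ε : ℝ, 0 < ε → d < ε * g) → d ≤ 0 := by
    intro g d hd
    refine le_of_forall_pos_le_add fun ε hε => ?_
    have h1 := hd (ε / (|g| + 1)) (by positivity)
    have h2 : ε / (|g| + 1) * g ≤ ε := by
      rw [div_mul_eq_mul_div, div_le_iff₀ (by positivity)]
      nlinarith [le_abs_self g]
    linarith
  -- Both cones are invariant under positive scaling, so the separating threshold can only be zero.
  have hc0 : c = 0 := by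
    apply le_antisymm
    · exact hscale (f u) c fun ε hε => by
        simpa using hup2 _ (smul_mem_upperCone (mem_upperCone hu hup) hε)
    · have := hscale (-(f l)) (-c) fun ε hε => by
        have := hlo _ (smul_mem_upperCone (mem_upperCone (r := fun x y => r y x) hl hpl) hε)
        simp only [map_smul, smul_eq_mul] at this
        linarith
      linarith
  subst hc0
  have fU : ∀ x ∈ posSimplex U, r x p → 0 < f x := fun x hx hr => hup2 x (mem_upperCone hx hr)
  have fL : ∀ x ∈ posSimplex U, r p x → f x < 0 := fun x hx hr =>
    hlo x (mem_upperCone (r := fun x y => r y x) hx hr)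
  have hlim : ∀ A B : ℝ, (∀ t : ℝ, 0 < t → t ≤ 1 → 0 < (1 - t) * A + t * B) → 0 ≤ A := by
    intro A B hAB
    by_contra hn
    have hB : 0 < B := by simpa using hAB 1 one_pos le_rfl
    have h1 := hAB (-A / (B - A)) (div_pos (by linarith) (by linarith))
      (by rw [div_le_one (by linarith)]; linarith)
    have : (1 - -A / (B - A)) * A + -A / (B - A) * B = 0 := by
      have : B - A ≠ 0 := by linarith
      field_simp; ring
    linarith
  -- By dominance, mixing a tied point with `l` or `u` gives full-support points that are strictly
  -- worse or better; letting the weight tend to zero bounds `f x` from both sides.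
  have fT : ∀ x ∈ stdSimplex ℝ U, Tie r p x → f x = 0 := by
    intro x hx ht
    apply le_antisymm
    · have := hlim (-(f x)) (-(f l)) fun t h0 h1 => by
        have := fL _ (posSimplex_line hx hl h0 h1)
          (h.rel_mix_of_rel_of_tie hp hl.1 hx hpl ht h0 h1)
        simp only [map_add, map_smul, smul_eq_mul] at this
        linarith
      linarith
    · exact hlim (f x) (f u) fun t h0 h1 => by
        have := fU _ (posSimplex_line hx hu h0 h1)
          (h.mix_rel_of_rel_of_tie hp hu.1 hx hup ht h0 h1)
        simpa using this
  -- Points without full support are reached through a tied mixture of `x` and `l`, at which `f`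
  -- vanishes while `f l` is negative.
  have gU : ∀ x ∈ stdSimplex ℝ U, r x p → 0 < f x := by
    intro x hx hr
    obtain ⟨t, h0, h1, ht⟩ := h.exists_tie_between hp hx hl.1 hr hpl
    have h2 := fT _ (h.mem_line hl.1 hx h0.le h1.le) ht
    have h3 := fL l hl hpl
    simp only [map_add, map_smul, smul_eq_mul] at h2
    by_contra hn
    nlinarith
  have gL : ∀ x ∈ stdSimplex ℝ U, r p x → f x < 0 := by
    intro x hx hr
    obtain ⟨t, h0, h1, ht⟩ := h.exists_tie_between hp hu.1 hx hup hr
    have h2 := fT _ (h.mem_line hx hu.1 h0.le h1.le) ht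
    have h3 := fU u hu hup
    simp only [map_add, map_smul, smul_eq_mul] at h2
    by_contra hn
    nlinarith
  refine ⟨f.toLinearMap, fun q hq => ?_⟩
  simp only [ContinuousLinearMap.coe_coe]
  by_cases h1 : r q p
  · have h2 := gU q hq h1
    have h3 := h.asymm q hq p hp h1
    exact ⟨by simp [h1, h2], by simp [h3, h2.le]⟩
  by_cases h2 : r p q
  · have h3 := gL q hq h2
    exact ⟨by simp [h1, h3.le], by simp [h2, h3]⟩
  · have h3 := fT q hq ⟨h2, h1⟩
    exact ⟨by simp [h1, h3], by simp [h2, h3]⟩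

/-- The reflection of a full-support point shows that it has better points if it has worse ones. -/
theorem exists_upper_of_lower (h : IsConvexPref (stdSimplex ℝ U) r) (hp : p ∈ posSimplex U)
    {l : U → ℝ} (hl : l ∈ stdSimplex ℝ U) (hpl : r p l) : ∃ u ∈ stdSimplex ℝ U, r u p := by
  have hv : ∑ a, (p - l) a = 0 := by
    simp [Finset.sum_sub_distrib, hp.1.2, hl.2]
  obtain ⟨β, hβ, hm⟩ := posSimplex_move hp hv
  have huC := (hm β (abs_of_pos hβ).le).1
  refine ⟨_, huC, ?_⟩
  by_contra hn
  have hb1 : (0 : ℝ) < 1 + β := by linarith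
  -- As `p` lies strictly between its reflection and `l`, a reflection that is not better would make
  -- `p` better than itself.
  have e : p = (1 - β / (1 + β)) • (p + β • (p - l)) + (β / (1 + β)) • l := by
    match_scalars <;> field_simp <;> ring
  by_cases hr : r p (p + β • (p - l))
  · have := (h.convex_lower p hp.1 ⟨huC, hr⟩ ⟨hl, hpl⟩ (a := 1 - β / (1 + β))
      (b := β / (1 + β)) (by rw [sub_nonneg, div_le_one hb1]; linarith) (by positivity)
      (by ring)).2
    rw [← e] at this
    exact h.irrefl hp.1 this
  · have := h.rel_mix_of_rel_of_tie hp.1 hl huC hpl ⟨hr, hn⟩ (t := β / (1 + β))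
      (by positivity) (by rw [div_le_one hb1]; linarith)
    rw [← e] at this
    exact h.irrefl hp.1 this

theorem exists_describesAt_of_not_tie (h : IsConvexPref (stdSimplex ℝ U) r)
    (hp : p ∈ posSimplex U) {q : U → ℝ} (hq : q ∈ stdSimplex ℝ U) (hpq : ¬ Tie r p q) :
    ∃ L : (U → ℝ) →ₗ[ℝ] ℝ, DescribesAt r p L := by
  by_cases h1 : r p q
  · exact h.exists_describesAt hp.1 (h.exists_upper_of_lower hp hq h1) ⟨q, hq, h1⟩
  · have h2 : r q p := by by_contra h2; exact hpq ⟨h1, h2⟩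
    exact h.exists_describesAt hp.1 ⟨q, hq, h2⟩ (h.swap.exists_upper_of_lower hp hq h2)

end IsConvexPref

end Functionals

/-! ### Local Jensen equations imply affinity. -/

section Jensen

/-- Maximum principle: at the largest maximizer, if it is interior, the Jensen equation makes a
point to its right a maximizer as well. -/
theorem nonpos_of_local_jensen {G : ℝ → ℝ} (hc : ContinuousOn G (Set.Icc 0 1)) (h0 : G 0 = 0)
    (h1 : G 1 = 0) (hJ : ∀ s ∈ Set.Ioo (0 : ℝ) 1, ∃ h₀ > 0, ∀ h, 0 < h → h < h₀ →
      G (s + h) + G (s - h) = 2 * G s) : ∀ s ∈ Set.Icc (0 : ℝ) 1, G s ≤ 0 := by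
  obtain ⟨m, hm, hmax⟩ := isCompact_Icc.exists_isMaxOn
    (Set.nonempty_Icc.2 (zero_le_one (α := ℝ))) hc
  rw [isMaxOn_iff] at hmax
  intro s hs
  refine (hmax s hs).trans ?_
  by_contra hpos
  push Not at hpos
  have hcomp : IsCompact {x ∈ Set.Icc (0 : ℝ) 1 | G m ≤ G x} := by
    have : {x ∈ Set.Icc (0 : ℝ) 1 | G m ≤ G x} = Set.Icc 0 1 ∩ G ⁻¹' Set.Ici (G m) := rfl
    rw [this]
    exact isCompact_Icc.of_isClosed_subset
      (hc.preimage_isClosed_of_isClosed isClosed_Icc isClosed_Ici) Set.inter_subset_left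
  obtain ⟨y, ⟨hy, hym⟩, hyM⟩ := hcomp.exists_isGreatest ⟨m, hm, le_rfl⟩
  have hy0 : 0 < y := lt_of_le_of_ne hy.1 fun e => by rw [← e, h0] at hym; linarith
  have hy1 : y < 1 := lt_of_le_of_ne hy.2 fun e => by rw [e, h1] at hym; linarith
  obtain ⟨h₀, hh₀, hJ⟩ := hJ y ⟨hy0, hy1⟩
  have hd : 0 < min (h₀ / 2) (min y (1 - y)) :=
    lt_min (by linarith) (lt_min hy0 (by linarith))
  have d1 := min_le_left (h₀ / 2) (min y (1 - y))
  have d2 := (min_le_right (h₀ / 2) (min y (1 - y))).trans (min_le_left _ _)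
  have d3 := (min_le_right (h₀ / 2) (min y (1 - y))).trans (min_le_right _ _)
  set d := min (h₀ / 2) (min y (1 - y))
  have hj := hJ d hd (by linarith)
  have m1 := hmax (y + d) ⟨by linarith, by linarith⟩
  have m2 := hmax (y - d) ⟨by linarith, by linarith⟩
  have : y + d ≤ y := hyM ⟨⟨by linarith, by linarith⟩, by linarith⟩
  linarith

/-- The difference of `F` and its chord satisfies the same equation and vanishes at both ends; the
maximum principle applies to it and to its negative. -/
theorem affine_of_local_jensen {F : ℝ → ℝ} (hc : ContinuousOn F (Set.Icc 0 1))
    (hJ : ∀ s ∈ Set.Ioo (0 : ℝ) 1, ∃ h₀ > 0, ∀ h, 0 < h → h < h₀ →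
      F (s + h) + F (s - h) = 2 * F s) :
    ∀ s ∈ Set.Icc (0 : ℝ) 1, F s = (1 - s) * F 0 + s * F 1 := by
  intro s hs
  have hl : Continuous fun s : ℝ => (1 - s) * F 0 + s * F 1 := by fun_prop
  apply le_antisymm
  · have := nonpos_of_local_jensen (G := fun s => F s - ((1 - s) * F 0 + s * F 1))
      (hc.sub hl.continuousOn) (by ring) (by ring) (fun s hs => ?_) s hs
    · linarith
    · obtain ⟨h₀, h1, h2⟩ := hJ s hs
      exact ⟨h₀, h1, fun h h3 h4 => by linear_combination h2 h h3 h4⟩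
  · have := nonpos_of_local_jensen (G := fun s => ((1 - s) * F 0 + s * F 1) - F s)
      (hl.continuousOn.sub hc) (by ring) (by ring) (fun s hs => ?_) s hs
    · linarith
    · obtain ⟨h₀, h1, h2⟩ := hJ s hs
      exact ⟨h₀, h1, fun h h3 h4 => by linear_combination -h2 h h3 h4⟩

end Jensen

/-! ### Normalized functionals along a segment and the triangle identity. -/

section Lines

variable {U : Type*} [Fintype U] {r : (U → ℝ) → (U → ℝ) → Prop}

/-- The functionals `L s` describe `r` along the segment from `p` to `q` and are normalized in the
direction of the segment. -/
structure DescribesLine (r : (U → ℝ) → (U → ℝ) → Prop) (p q : U → ℝ)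
    (L : ℝ → (U → ℝ) →ₗ[ℝ] ℝ) : Prop where
  pref : IsConvexPref (stdSimplex ℝ U) r
  left : p ∈ posSimplex U
  right : q ∈ posSimplex U
  describes : ∀ s ∈ Set.Icc (0 : ℝ) 1, DescribesAt r ((1 - s) • p + s • q) (L s)
  normalized : ∀ s ∈ Set.Icc (0 : ℝ) 1, L s q - L s p = 1

namespace DescribesLine

variable {p q : U → ℝ} {L : ℝ → (U → ℝ) →ₗ[ℝ] ℝ}

theorem mem (h : DescribesLine r p q L) {s : ℝ} (hs : s ∈ Set.Icc (0 : ℝ) 1) :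
    (1 - s) • p + s • q ∈ posSimplex U :=
  posSimplex_convex h.left h.right (by linarith [hs.2]) hs.1 (by ring)

theorem apply_left (h : DescribesLine r p q L) {s : ℝ} (hs : s ∈ Set.Icc (0 : ℝ) 1) :
    L s p = -s := by
  have h1 := ((h.describes s hs).tie_iff (h.mem hs).1).1 (h.pref.tie_refl (h.mem hs).1)
  have h2 := h.normalized s hs
  simp only [map_add, map_smul, smul_eq_mul] at h1
  linear_combination h1 - s * h2

theorem apply_right (h : DescribesLine r p q L) {s : ℝ} (hs : s ∈ Set.Icc (0 : ℝ) 1) :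
    L s q = 1 - s := by
  have h2 := h.normalized s hs
  rw [h.apply_left hs] at h2
  linarith

/-- The base point `z`, shifted along `v` minus slightly less than `L s₀ v` times the direction of
the segment, is strictly better than `z`. Openness preserves this for nearby points of the segment,
and the functionals there turn it into the bound. -/
theorem lower_semicontinuous (h : DescribesLine r p q L) {v : U → ℝ} (hv : ∑ a, v a = 0) {s₀ : ℝ}
    (hs₀ : s₀ ∈ Set.Icc (0 : ℝ) 1) {ε : ℝ} (hε : 0 < ε) :
    ∃ δ > 0, ∀ s ∈ Set.Icc (0 : ℝ) 1, |s - s₀| < δ → L s₀ v - ε < L s v := by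
  have hz := h.mem hs₀
  set z := (1 - s₀) • p + s₀ • q with hzdef
  have hpq : ∑ a, (q - p) a = 0 := by
    simp [Finset.sum_sub_distrib, h.left.1.2, h.right.1.2]
  have hw : ∑ a, (v - (L s₀ v - ε / 2) • (q - p)) a = 0 := by
    simp only [Pi.sub_apply, Pi.smul_apply, smul_eq_mul, Finset.sum_sub_distrib,
      ← Finset.mul_sum] at hpq ⊢
    rw [hv, hpq]; ring
  obtain ⟨β, hβ, hm⟩ := posSimplex_move hz hw
  have hwC := (hm β (abs_of_pos hβ).le).1
  have hr : r (z + β • (v - (L s₀ v - ε / 2) • (q - p))) z := by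
    rw [((h.describes s₀ hs₀) _ hwC).1]
    simp only [hzdef, map_add, map_smul, map_sub, smul_eq_mul, h.apply_left hs₀, h.apply_right hs₀]
    have : 0 < β * ε := by positivity
    nlinarith
  have hcont : Tendsto (fun s : ℝ => (1 - s) • p + s • q) (𝓝[Set.Icc 0 1] s₀)
      (𝓝[stdSimplex ℝ U] z) := by
    apply tendsto_nhdsWithin_of_tendsto_nhds_of_eventually_within
    · have : Continuous (fun s : ℝ => (1 - s) • p + s • q) := by fun_prop
      exact (this.tendsto s₀).mono_left nhdsWithin_le_nhds
    · filter_upwards [self_mem_nhdsWithin] with s hs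
      exact (h.mem hs).1
  have hev := hcont.eventually (h.pref.open_lower _ hwC _ hz.1 hr)
  rw [eventually_nhdsWithin_iff, Metric.eventually_nhds_iff] at hev
  obtain ⟨η, hη, hev⟩ := hev
  refine ⟨min η (β * (ε / 2)), lt_min hη (by positivity), fun s hs hd => ?_⟩
  have hr' := hev (y := s) (by rw [Real.dist_eq]; exact hd.trans_le (min_le_left _ _)) hs
  rw [((h.describes s hs) _ hwC).1] at hr'
  simp only [hzdef, map_add, map_smul, map_sub, smul_eq_mul, h.apply_left hs, h.apply_right hs]
    at hr'
  have hd2 := abs_lt.1 (hd.trans_le (min_le_right _ _))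
  have : 0 < β * (L s v - (L s₀ v - ε)) := by nlinarith
  have := pos_of_mul_pos_right this hβ.le
  linarith

theorem continuousOn (h : DescribesLine r p q L) {v : U → ℝ} (hv : ∑ a, v a = 0) :
    ContinuousOn (fun s => L s v) (Set.Icc 0 1) := by
  rw [Metric.continuousOn_iff]
  intro s₀ hs₀ ε hε
  obtain ⟨δ, h1, h2⟩ := h.lower_semicontinuous hv hs₀ hε
  obtain ⟨δ', h3, h4⟩ := h.lower_semicontinuous (v := -v) (by simp [hv]) hs₀ hε
  refine ⟨min δ δ', lt_min h1 h3, fun s hs hd => ?_⟩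
  rw [Real.dist_eq] at hd ⊢
  have h5 := h2 s hs (hd.trans_le (min_le_left _ _))
  have h6 := h4 s hs (hd.trans_le (min_le_right _ _))
  simp only [map_neg] at h6
  rw [abs_lt]; constructor <;> linarith

/-- The symmetry axiom is applied to the points at `s - d` and `s + d` and to a point off the
segment that is tied with their midpoint. Its hypothesis is a tie at `s - k`, its conclusion the
mirrored tie at `s + k`; the two equations add up to Jensen's. -/
theorem local_jensen (h : DescribesLine r p q L) {v : U → ℝ} (hv : ∑ a, v a = 0) {s : ℝ}
    (hs : s ∈ Set.Ioo (0 : ℝ) 1) :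
    ∃ h₀ > 0, ∀ k, 0 < k → k < h₀ → L (s + k) v + L (s - k) v = 2 * L s v := by
  refine ⟨min s (1 - s) / 3, by have := lt_min hs.1 (sub_pos.2 hs.2); positivity,
    fun k hk0 hk => ?_⟩
  have hk1 : 3 * k < s := by have := min_le_left s (1 - s); linarith
  have hk2 : 3 * k < 1 - s := by have := min_le_right s (1 - s); linarith
  have I0 : s ∈ Set.Icc (0 : ℝ) 1 := ⟨hs.1.le, hs.2.le⟩
  have I1 : s - k ∈ Set.Icc (0 : ℝ) 1 := ⟨by linarith, by linarith⟩
  have I2 : s + k ∈ Set.Icc (0 : ℝ) 1 := ⟨by linarith, by linarith⟩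
  have hpq : ∑ a, (q - p) a = 0 := by
    simp [Finset.sum_sub_distrib, h.left.1.2, h.right.1.2]
  set σ := L s v with hσ
  have hw : ∑ a, (v - σ • (q - p)) a = 0 := by
    simp only [Pi.sub_apply, Pi.smul_apply, smul_eq_mul, Finset.sum_sub_distrib,
      ← Finset.mul_sum] at hpq ⊢
    rw [hv, hpq]; ring
  have hLw : ∀ t ∈ Set.Icc (0 : ℝ) 1, L t (v - σ • (q - p)) = L t v - σ := fun t ht => by
    simp only [map_sub, map_smul, smul_eq_mul, h.apply_left ht, h.apply_right ht]; ring
  set w := v - σ • (q - p) with hwdef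
  obtain ⟨β₁, hβ₁, hm⟩ := posSimplex_move (h.mem I0) hw
  set D := L (s - k) v - σ with hD
  set β := min β₁ (k / (2 * (|D| + 1))) with hβdef
  have hβ : 0 < β := lt_min hβ₁ (by positivity)
  have hβD : β * |D| ≤ k / 2 := by
    have h1 : β ≤ k / (2 * (|D| + 1)) := min_le_right _ _
    rw [le_div_iff₀ (by positivity)] at h1
    nlinarith [abs_nonneg D]
  have hβD1 : β * D ≤ k / 2 := (mul_le_mul_of_nonneg_left (le_abs_self D) hβ.le).trans hβD
  have hβD2 : -(k / 2) ≤ β * D := by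
    have := mul_le_mul_of_nonneg_left (neg_abs_le D) hβ.le
    linarith
  have hbC := (hm β (by rw [abs_of_pos hβ]; exact min_le_left _ _)).1
  -- With this `d`, the point at `s - k` is tied with the midpoint of the point at `s - d` and the
  -- shifted point. The bound on `β` keeps `d` within `k / 2` of `2 * k`, so all parameters stay in
  -- the unit interval.
  set d := 2 * k + β * D with hd
  have hd1 : 3 / 2 * k ≤ d := by linarith
  have hd2 : d ≤ 5 / 2 * k := by linarith
  have Ia : s - d ∈ Set.Icc (0 : ℝ) 1 := ⟨by linarith, by linarith⟩
  have Ic : s + d ∈ Set.Icc (0 : ℝ) 1 := ⟨by linarith, by linarith⟩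
  have haC := (h.mem Ia).1
  have hcC := (h.mem Ic).1
  have hd0 : 0 < d := by linarith
  have hdne : d ≠ 0 := hd0.ne'
  have hT0 : Tie r ((1 - s) • p + s • q + β • w) ((1 / 2 : ℝ) • ((1 - (s - d)) • p + (s - d) • q) +
      (1 / 2 : ℝ) • ((1 - (s + d)) • p + (s + d) • q)) := by
    have e : (1 / 2 : ℝ) • ((1 - (s - d)) • p + (s - d) • q) +
      (1 / 2 : ℝ) • ((1 - (s + d)) • p + (s + d) • q) = (1 - s) • p + s • q := by module
    rw [e]
    refine Tie.symm (((h.describes s I0).tie_iff hbC).2 ?_)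
    rw [map_add, map_smul, hLw s I0]
    simp only [map_add, map_smul, smul_eq_mul, h.apply_left I0, h.apply_right I0]
    ring
  have hmid : ∀ {x y : U → ℝ}, x ∈ stdSimplex ℝ U → y ∈ stdSimplex ℝ U →
      (1 / 2 : ℝ) • x + (1 / 2 : ℝ) • y ∈ stdSimplex ℝ U := fun hx hy =>
    h.pref.convex hx hy (by norm_num) (by norm_num) (by norm_num)
  have key := h.pref.symm _ haC _ hbC _ hcC ((d + k) / (2 * d)) (by positivity)
    (by rw [div_lt_one (by positivity)]; linarith) hT0 ?_
  · have e : ((d + k) / (2 * d)) • ((1 - (s + d)) • p + (s + d) • q) +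
      (1 - (d + k) / (2 * d)) • ((1 - (s - d)) • p + (s - d) • q) =
        (1 - (s + k)) • p + (s + k) • q := by
      match_scalars <;> field_simp <;> ring
    rw [e, (h.describes _ I2).tie_iff (hmid hcC hbC)] at key
    rw [map_add, map_smul, map_smul, map_add _ _ (β • w), map_smul _ β, hLw _ I2] at key
    simp only [map_add, map_smul, smul_eq_mul, h.apply_left I2, h.apply_right I2] at key
    have : β * (L (s + k) v + L (s - k) v - 2 * σ) = 0 := by
      linear_combination 2 * key - hd - β * hD
    rcases mul_eq_zero.1 this with h1 | h1
    · exact absurd h1 hβ.ne'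
    · linarith
  · have e : ((d + k) / (2 * d)) • ((1 - (s - d)) • p + (s - d) • q) +
      (1 - (d + k) / (2 * d)) • ((1 - (s + d)) • p + (s + d) • q) =
        (1 - (s - k)) • p + (s - k) • q := by
      match_scalars <;> field_simp <;> ring
    rw [e, (h.describes _ I1).tie_iff (hmid haC hbC)]
    rw [map_add, map_smul, map_smul, map_add _ _ (β • w), map_smul _ β, hLw _ I1]
    simp only [map_add, map_smul, smul_eq_mul, h.apply_left I1, h.apply_right I1]
    linear_combination (-1 / 2) * hd

/-- Along a strict segment, the normalized describing functionals are affine. -/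
theorem affine (h : DescribesLine r p q L) {x : U → ℝ} (hx : x ∈ stdSimplex ℝ U) {s : ℝ}
    (hs : s ∈ Set.Icc (0 : ℝ) 1) : L s x = (1 - s) * L 0 x + s * L 1 x := by
  have hv : ∑ a, (x - p) a = 0 := by simp [Finset.sum_sub_distrib, h.left.1.2, hx.2]
  have key := affine_of_local_jensen (h.continuousOn hv) (fun s hs => h.local_jensen hv hs) s hs
  simp only [map_sub, h.apply_left hs, h.apply_left (Set.left_mem_Icc.2 zero_le_one),
    h.apply_left (Set.right_mem_Icc.2 zero_le_one)] at key
  linear_combination key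

end DescribesLine

namespace IsConvexPref

variable {p q e : U → ℝ}

/-- At the tied point of the segment, affinity gives one linear equation for the weights `1 - s` and
`s`, with coefficients from the rescaled `Lp` and `Lq`; the functional at `e` gives another.
Eliminating the weights yields the identity. -/
theorem triangle_identity_of_tie (h : IsConvexPref (stdSimplex ℝ U) r) (hp : p ∈ posSimplex U)
    (hq : q ∈ posSimplex U) (he : e ∈ stdSimplex ℝ U) (hqp : r q p) {s : ℝ} (h0 : 0 < s)
    (h1 : s < 1) (ht : Tie r e ((1 - s) • p + s • q)) {Lp Lq Le : (U → ℝ) →ₗ[ℝ] ℝ}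
    (hLp : DescribesAt r p Lp) (hLq : DescribesAt r q Lq) (hLe : DescribesAt r e Le) :
    Le p * Lp q * Lq e = -(Lp e * Lq p * Le q) := by
  have hpq1 : 0 < Lp q := (hLp q hq.1).1.1 hqp
  have hqp1 : Lq p < 0 := (hLq p hp.1).2.1 hqp
  have hpp : Lp p = 0 := (hLp.tie_iff hp.1).1 (h.tie_refl hp.1)
  have hqq : Lq q = 0 := (hLq.tie_iff hq.1).1 (h.tie_refl hq.1)
  -- The functionals at the ends are prescribed as multiples of `Lp` and `Lq`; at inner points `q`
  -- is better and `p` is worse, so a functional exists and can be normalized.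
  have hex : ∀ s : ℝ, ∃ L : (U → ℝ) →ₗ[ℝ] ℝ, (s ∈ Set.Icc (0 : ℝ) 1 →
      DescribesAt r ((1 - s) • p + s • q) L ∧ L q - L p = 1) ∧
      (s = 0 → L = (Lp q)⁻¹ • Lp) ∧ (s = 1 → L = (-Lq p)⁻¹ • Lq) := by
    intro s
    by_cases hs0 : s = 0
    · subst hs0
      refine ⟨(Lp q)⁻¹ • Lp, fun _ => ⟨?_, ?_⟩, fun _ => rfl, fun h => absurd h (by norm_num)⟩
      · have := hLp.smul (inv_pos.2 hpq1)
        simpa using this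
      · simp [hpp, hpq1.ne']
    by_cases hs1 : s = 1
    · subst hs1
      refine ⟨(-Lq p)⁻¹ • Lq, fun _ => ⟨?_, ?_⟩, fun h => absurd h (by norm_num), fun _ => rfl⟩
      · have := hLq.smul (inv_pos.2 (neg_pos.2 hqp1))
        simpa using this
      · simp only [LinearMap.smul_apply, hqq, smul_eq_mul]
        have := hqp1.ne
        field_simp; ring
    by_cases hs : s ∈ Set.Icc (0 : ℝ) 1
    · have hz := posSimplex_convex hp hq (by linarith [hs.2] : 0 ≤ 1 - s) hs.1 (by ring)
      have s0 : 0 < s := lt_of_le_of_ne hs.1 (Ne.symm hs0)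
      have s1 : s < 1 := lt_of_le_of_ne hs.2 hs1
      have hz1 : r q ((1 - s) • p + s • q) := by
        have := h.rel_line_left hq.1 hp.1 hqp (t := 1 - s) (by linarith) (by linarith)
        convert this using 1
        module
      have hz2 : r ((1 - s) • p + s • q) p := by
        have := h.rel_line_right hq.1 hp.1 hqp (t := 1 - s) (by linarith) (by linarith)
        convert this using 1
        module
      obtain ⟨L, hL⟩ := h.exists_describesAt hz.1 ⟨q, hq.1, hz1⟩ ⟨p, hp.1, hz2⟩
      have a1 := (hL q hq.1).1.1 hz1
      have a2 := (hL p hp.1).2.1 hz2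
      have a3 : 0 < L q - L p := by linarith
      refine ⟨(L q - L p)⁻¹ • L, fun _ => ⟨hL.smul (inv_pos.2 a3), ?_⟩,
        fun h => absurd h hs0, fun h => absurd h hs1⟩
      simp only [LinearMap.smul_apply, smul_eq_mul]
      field_simp
    · exact ⟨0, fun h => absurd h hs, fun h => absurd h hs0, fun h => absurd h hs1⟩
  choose L hL hL0 hL1 using hex
  have hline : DescribesLine r p q L :=
    ⟨h, hp, hq, fun s hs => (hL s hs).1, fun s hs => (hL s hs).2⟩
  have hs : s ∈ Set.Icc (0 : ℝ) 1 := ⟨h0.le, h1.le⟩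
  have haff := hline.affine he hs
  rw [((hL s hs).1.tie_iff he).1 ht.symm, hL0 0 rfl, hL1 1 rfl] at haff
  have hez := (hLe.tie_iff (hline.mem hs).1).1 ht
  simp only [map_add, map_smul, smul_eq_mul, LinearMap.smul_apply] at hez haff
  have hA : (1 - s) * Lp e * Lq p = s * Lq e * Lp q := by
    have := hqp1.ne
    have := hpq1.ne'
    field_simp at haff
    linear_combination -haff
  have : s * (Le p * Lp q * Lq e + Lp e * Lq p * Le q) = 0 := by
    linear_combination Lp e * Lq p * hez - Le p * hA
  rcases mul_eq_zero.1 this with h3 | h3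
  · exact absurd h3 h0.ne'
  · linarith

theorem triangle_identity_of_between (h : IsConvexPref (stdSimplex ℝ U) r) (hp : p ∈ posSimplex U)
    (hq : q ∈ posSimplex U) (he : e ∈ stdSimplex ℝ U) (hpq : r p q ∨ r q p) (hpe : r p e)
    (heq : r e q) {Lp Lq Le : (U → ℝ) →ₗ[ℝ] ℝ}
    (hLp : DescribesAt r p Lp) (hLq : DescribesAt r q Lq) (hLe : DescribesAt r e Le) :
    Le p * Lp q * Lq e = -(Lp e * Lq p * Le q) := by
  obtain ⟨t, h0, h1, ht⟩ := h.exists_tie_between he hp.1 hq.1 hpe heq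
  rcases hpq with hr | hr
  · linear_combination h.triangle_identity_of_tie hq hp he hr h0 h1 ht hLq hLp hLe
  · refine h.triangle_identity_of_tie hp hq he hr (s := 1 - t) (by linarith) (by linarith) ?_
      hLp hLq hLe
    convert ht using 1
    module

/-- The cyclic identity for three pairwise comparable full-support points. -/
theorem triangle_identity (h : IsConvexPref (stdSimplex ℝ U) r) (hp : p ∈ posSimplex U)
    (hq : q ∈ posSimplex U) (he : e ∈ posSimplex U) (hpq : ¬ Tie r p q) (hpe : ¬ Tie r p e)
    (hqe : ¬ Tie r q e) {Lp Lq Le : (U → ℝ) →ₗ[ℝ] ℝ}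
    (hLp : DescribesAt r p Lp) (hLq : DescribesAt r q Lq) (hLe : DescribesAt r e Le) :
    Le p * Lp q * Lq e = -(Lp e * Lq p * Le q) := by
  have hor : ∀ {x y : U → ℝ}, ¬ Tie r x y → r x y ∨ r y x := by
    intro x y hxy; unfold Tie at hxy; tauto
  rcases hor hpq with h1 | h1 <;> rcases hor hpe with h2 | h2 <;> rcases hor hqe with h3 | h3
  · linear_combination h.triangle_identity_of_between hp he hq.1 (hor hpe) h1 h3 hLp hLe hLq
  · linear_combination h.triangle_identity_of_between hp hq he.1 (hor hpq) h2 h3 hLp hLq hLe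
  · linear_combination h.triangle_identity_of_between hp he hq.1 (hor hpe) h1 h3 hLp hLe hLq
  · linear_combination h.triangle_identity_of_between he hq hp.1 (hor hqe).symm h2 h1 hLe hLq hLp
  · linear_combination h.triangle_identity_of_between hq he hp.1 (hor hqe) h1 h2 hLq hLe hLp
  · linear_combination h.triangle_identity_of_between he hp hq.1 (hor hpe).symm h3 h1 hLe hLp hLq
  · linear_combination h.triangle_identity_of_between hq hp he.1 (hor hpq).symm h3 h2 hLq hLp hLe
  · linear_combination h.triangle_identity_of_between he hp hq.1 (hor hpe).symm h3 h1 hLe hLp hLq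

end IsConvexPref

end Lines

/-! ### The representation theorem: gluing functionals into a bilinear form. -/

section Representation

variable {U : Type*} [Fintype U] {r : (U → ℝ) → (U → ℝ) → Prop}

theorem exists_pos_forall_pos_of_affine {A B : ℝ} (hA : 0 < A) :
    ∃ δ : ℝ, 0 < δ ∧ δ ≤ 1 ∧ ∀ t, 0 ≤ t → t ≤ δ → 0 < (1 - t) * A + t * B := by
  have hd : 0 < 2 * (A + |B|) := by positivity
  refine ⟨A / (2 * (A + |B|)), by positivity, ?_, fun t h0 h1 => ?_⟩
  · rw [div_le_one hd]; linarith [abs_nonneg B]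
  · rw [le_div_iff₀ hd] at h1
    have := mul_le_mul_of_nonneg_left (neg_abs_le B) h0
    nlinarith

namespace IsConvexPref

/-- The free factor is fixed by imposing skew-symmetry against a reference point `e`; it is positive
because both functionals describe the same strict comparison. -/
theorem exists_describesAt_normalized (h : IsConvexPref (stdSimplex ℝ U) r) {e w : U → ℝ}
    (he : e ∈ posSimplex U) {Le : (U → ℝ) →ₗ[ℝ] ℝ} (hLe : DescribesAt r e Le)
    (hw : w ∈ posSimplex U) (hne : ¬ Tie r e w) :
    ∃ L : (U → ℝ) →ₗ[ℝ] ℝ, DescribesAt r w L ∧ L e = -Le w := by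
  obtain ⟨L, hL⟩ := h.exists_describesAt_of_not_tie hw he.1 (fun h => hne h.symm)
  have hpos : 0 < -Le w / L e := by
    by_cases h1 : r e w
    · exact div_pos (neg_pos.2 ((hLe w hw.1).2.1 h1)) ((hL e he.1).1.1 h1)
    · have h2 : r w e := by by_contra h2; exact hne ⟨h1, h2⟩
      have h3 := (hLe w hw.1).1.1 h2
      exact div_pos_of_neg_of_neg (by linarith) ((hL e he.1).2.1 h2)
  have hLe0 : L e ≠ 0 := fun h0 => by rw [h0, div_zero] at hpos; exact lt_irrefl _ hpos
  refine ⟨(-Le w / L e) • L, hL.smul hpos, ?_⟩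
  simp only [LinearMap.smul_apply, smul_eq_mul]
  field_simp

/-- Skew-symmetry against `e` spreads to all pairs: substituted into the triangle identity, the
normalization leaves a nonzero factor times the desired sum. -/
theorem normalized_skew (h : IsConvexPref (stdSimplex ℝ U) r) {e w w' : U → ℝ}
    (he : e ∈ posSimplex U) {Le L L' : (U → ℝ) →ₗ[ℝ] ℝ} (hLe : DescribesAt r e Le)
    (hw : w ∈ posSimplex U) (hne : ¬ Tie r e w) (hw' : w' ∈ posSimplex U) (hne' : ¬ Tie r e w')
    (hL : DescribesAt r w L) (hLn : L e = -Le w) (hL' : DescribesAt r w' L')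
    (hLn' : L' e = -Le w') : L w' = -L' w := by
  by_cases ht : Tie r w w'
  · rw [(hL.tie_iff hw'.1).1 ht, (hL'.tie_iff hw.1).1 ht.symm, neg_zero]
  · have key := h.triangle_identity hw hw' he ht (fun h => hne h.symm) (fun h => hne' h.symm)
      hL hL' hLe
    rw [hLn, hLn'] at key
    rw [hLe.tie_iff hw.1] at hne
    rw [hLe.tie_iff hw'.1] at hne'
    have : (Le w * Le w') * (L w' + L' w) = 0 := by linear_combination -key
    rcases mul_eq_zero.1 this with h1 | h1
    · exact absurd h1 (mul_ne_zero hne hne')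
    · linarith

/-- Small shifts of `w` stay positive and off the kernel of `L`, so their differences span all
directions with coordinate sum zero; `w` itself supplies the remaining dimension. -/
theorem span_eq_top {L : (U → ℝ) →ₗ[ℝ] ℝ} {w : U → ℝ} (hw : w ∈ posSimplex U) (hL : L w < 0) :
    (⊤ : Submodule ℝ (U → ℝ)) ≤ Submodule.span ℝ {x ∈ posSimplex U | L x ≠ 0} := by
  have hwS : w ∈ Submodule.span ℝ {x ∈ posSimplex U | L x ≠ 0} :=
    Submodule.subset_span ⟨hw, hL.ne⟩
  have hz : ∀ v : U → ℝ, ∑ a, v a = 0 →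
      v ∈ Submodule.span ℝ {x ∈ posSimplex U | L x ≠ 0} := by
    intro v hv
    obtain ⟨β, hβ, hm⟩ := posSimplex_move hw hv
    set t := min β (-L w / (2 * (|L v| + 1))) with ht
    have ht0 : 0 < t := lt_min hβ (div_pos (by linarith) (by positivity))
    have ht1 : t * |L v| ≤ -L w / 2 := by
      have h1 : t ≤ -L w / (2 * (|L v| + 1)) := min_le_right _ _
      rw [le_div_iff₀ (by positivity)] at h1
      nlinarith [abs_nonneg (L v)]
    have h2 : w + t • v ∈ {x ∈ posSimplex U | L x ≠ 0} := by
      refine ⟨hm t (by rw [abs_of_pos ht0]; exact min_le_left _ _), ne_of_lt ?_⟩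
      have := mul_le_mul_of_nonneg_left (le_abs_self (L v)) ht0.le
      simp only [map_add, map_smul, smul_eq_mul]
      linarith
    have h3 := Submodule.smul_mem _ t⁻¹ (Submodule.sub_mem _ (Submodule.subset_span h2) hwS)
    rwa [add_sub_cancel_left, smul_smul, inv_mul_cancel₀ ht0.ne', one_smul] at h3
  intro x _
  have h1 : x - (∑ a, x a) • w ∈ Submodule.span ℝ {x ∈ posSimplex U | L x ≠ 0} := by
    refine hz _ ?_
    simp [Finset.sum_sub_distrib, ← Finset.mul_sum, hw.1.2]
  have := Submodule.add_mem _ h1 (Submodule.smul_mem _ (∑ a, x a) hwS)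
  simpa using this

/-- A skew-symmetric bilinear form that describes `r` at full-support points off a hyperplane. -/
theorem exists_skew_on_dense (h : IsConvexPref (stdSimplex ℝ U) r) {p₀ q₀ : U → ℝ}
    (hp₀ : p₀ ∈ stdSimplex ℝ U) (hq₀ : q₀ ∈ stdSimplex ℝ U) (hr : r p₀ q₀) :
    ∃ (B : (U → ℝ) →ₗ[ℝ] (U → ℝ) →ₗ[ℝ] ℝ) (L : (U → ℝ) →ₗ[ℝ] ℝ),
      (∀ x y, B x y = -B y x) ∧ (∃ w ∈ posSimplex U, L w ≠ 0) ∧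
      ∀ w ∈ posSimplex U, L w ≠ 0 → DescribesAt r w (B w) := by
  have hne : Nonempty U := by
    by_contra hne
    rw [not_nonempty_iff] at hne
    have := hp₀.2
    simp at this
  obtain ⟨e, he, heq⟩ := h.exists_pos_upper hq₀ hp₀ hr
  obtain ⟨w₀, hw₀, hew⟩ := h.swap.exists_pos_upper he.1 hq₀ heq
  obtain ⟨Le, hLe⟩ := h.exists_describesAt_of_not_tie he hw₀.1 fun ht => ht.1 hew
  have hLw₀ := (hLe w₀ hw₀.1).2.1 hew
  have hex : ∀ w, ∃ L : (U → ℝ) →ₗ[ℝ] ℝ, w ∈ {x ∈ posSimplex U | Le x ≠ 0} →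
      DescribesAt r w L ∧ L e = -Le w := by
    intro w
    by_cases hw : w ∈ {x ∈ posSimplex U | Le x ≠ 0}
    · obtain ⟨L, hL⟩ := h.exists_describesAt_normalized he hLe hw.1
        (by rw [hLe.tie_iff hw.1.1]; exact hw.2)
      exact ⟨L, fun _ => hL⟩
    · exact ⟨0, fun h => absurd h hw⟩
  choose Λ hΛ using hex
  have hskew : ∀ w ∈ {x ∈ posSimplex U | Le x ≠ 0}, ∀ w' ∈ {x ∈ posSimplex U | Le x ≠ 0},
      Λ w w' = -Λ w' w := fun w hw w' hw' =>
    h.normalized_skew he hLe hw.1 (by rw [hLe.tie_iff hw.1.1]; exact hw.2) hw'.1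
      (by rw [hLe.tie_iff hw'.1.1]; exact hw'.2) (hΛ w hw).1 (hΛ w hw).2 (hΛ w' hw').1 (hΛ w' hw').2
  -- A basis of full-support points comparable to `e`. Extending `Λ` linearly from it recovers `Λ w`
  -- at every such `w`, because skew-symmetry makes `Λ` linear in its index as well.
  let b := Module.Basis.ofSpan (span_eq_top (L := Le) hw₀ hLw₀)
  have hb : ∀ i, b i ∈ {x ∈ posSimplex U | Le x ≠ 0} := fun i =>
    Module.Basis.ofSpan_subset (span_eq_top (L := Le) hw₀ hLw₀) ⟨i, rfl⟩
  let B := b.constr ℝ (fun i => Λ (b i))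
  have hBb : ∀ i, B (b i) = Λ (b i) := fun i => b.constr_basis ℝ _ i
  have hB1 : ∀ w ∈ {x ∈ posSimplex U | Le x ≠ 0}, ∀ x, B x w = -Λ w x := by
    intro w hw x
    have : B.flip w = -Λ w := b.ext fun i => by
      rw [LinearMap.flip_apply, hBb, LinearMap.neg_apply, hskew _ (hb i) _ hw]
    have := LinearMap.congr_fun this x
    simpa using this
  have hB2 : ∀ w ∈ {x ∈ posSimplex U | Le x ≠ 0}, B w = Λ w := fun w hw =>
    b.ext fun i => by rw [hB1 _ (hb i), hskew _ (hb i) _ hw, neg_neg]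
  refine ⟨B, Le, fun x y => ?_, ⟨w₀, hw₀, hLw₀.ne⟩, fun w hw hL => ?_⟩
  · have : B x = -B.flip x := b.ext fun i => by
      rw [hB1 _ (hb i), LinearMap.neg_apply, LinearMap.flip_apply, hBb]
    rw [this]; simp
  · rw [hB2 w ⟨hw, hL⟩]; exact (hΛ w ⟨hw, hL⟩).1

theorem near_generic {L : (U → ℝ) →ₗ[ℝ] ℝ} {p w : U → ℝ} (hp : p ∈ stdSimplex ℝ U)
    (hw : w ∈ posSimplex U) (hL : L w ≠ 0) : ∃ δ : ℝ, 0 < δ ∧ δ ≤ 1 ∧ ∀ t, 0 < t → t ≤ δ →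
      (1 - t) • p + t • w ∈ posSimplex U ∧ L ((1 - t) • p + t • w) ≠ 0 := by
  simp only [map_add, map_smul, smul_eq_mul]
  rcases lt_trichotomy (L p) 0 with hA | hA | hA
  · obtain ⟨δ, h0, h1, h2⟩ := exists_pos_forall_pos_of_affine (A := -L p) (B := -L w)
      (by linarith)
    refine ⟨δ, h0, h1, fun t ht0 ht1 => ⟨posSimplex_line hp hw ht0 (ht1.trans h1), ne_of_lt ?_⟩⟩
    linarith [h2 t ht0.le ht1]
  · refine ⟨1, one_pos, le_rfl, fun t ht0 ht1 => ⟨posSimplex_line hp hw ht0 ht1, ?_⟩⟩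
    rw [hA, mul_zero, zero_add]
    exact mul_ne_zero ht0.ne' hL
  · obtain ⟨δ, h0, h1, h2⟩ := exists_pos_forall_pos_of_affine (A := L p) (B := L w) hA
    exact ⟨δ, h0, h1, fun t ht0 ht1 => ⟨posSimplex_line hp hw ht0 (ht1.trans h1),
      (h2 t ht0.le ht1).ne'⟩⟩

/-- The form is known only at generic points. If `p` did not beat the midpoint `m`, then, since `m`
beats a generic `t` near `q`, dominance would make `m` beat generic points near `p`, against the
sign of the form. Finally, `p` beating `m` forces `p` to beat `q`. -/
theorem rel_of_form_pos (h : IsConvexPref (stdSimplex ℝ U) r)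
    {B : (U → ℝ) →ₗ[ℝ] (U → ℝ) →ₗ[ℝ] ℝ} {L : (U → ℝ) →ₗ[ℝ] ℝ} (hB : ∀ x y, B x y = -B y x)
    {w : U → ℝ} (hw : w ∈ posSimplex U) (hLw : L w ≠ 0)
    (hD : ∀ w ∈ posSimplex U, L w ≠ 0 → DescribesAt r w (B w)) {p q : U → ℝ}
    (hp : p ∈ stdSimplex ℝ U) (hq : q ∈ stdSimplex ℝ U) (hpos : 0 < B q p) : r p q := by
  have hmC : (1 / 2 : ℝ) • p + (1 / 2 : ℝ) • q ∈ stdSimplex ℝ U :=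
    h.convex hp hq (by norm_num) (by norm_num) (by norm_num)
  have hpp : B p p = 0 := by linarith [hB p p]
  have hqq : B q q = 0 := by linarith [hB q q]
  have hpm : B p ((1 / 2 : ℝ) • p + (1 / 2 : ℝ) • q) < 0 := by
    simp only [map_add, map_smul, smul_eq_mul, hpp]
    linarith [hB p q]
  have hqm : 0 < B q ((1 / 2 : ℝ) • p + (1 / 2 : ℝ) • q) := by
    simp only [map_add, map_smul, smul_eq_mul, hqq]
    linarith
  have hmr : r p ((1 / 2 : ℝ) • p + (1 / 2 : ℝ) • q) := by
    set m := (1 / 2 : ℝ) • p + (1 / 2 : ℝ) • q with hm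
    obtain ⟨δ, hδ0, hδ1, hδ⟩ := exists_pos_forall_pos_of_affine (A := B q m) (B := B w m) hqm
    obtain ⟨δ', hδ0', hδ1', hδ'⟩ := near_generic hq hw hLw
    set τ := min δ δ'
    have hτ0 : 0 < τ := lt_min hδ0 hδ0'
    obtain ⟨ht, htL⟩ := hδ' τ hτ0 (min_le_right _ _)
    have htm := hδ τ hτ0.le (min_le_left _ _)
    have hrt : r m ((1 - τ) • q + τ • w) := by
      rw [(hD _ ht htL m hmC).1]
      simpa using htm
    set t := (1 - τ) • q + τ • w
    by_contra hn
    have hall : ∀ s : ℝ, 0 < s → s ≤ 1 → r m ((1 - s) • p + s • t) := by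
      intro s h0 h1
      by_cases hmp : r m p
      · exact (h.convex_lower m hmC ⟨hp, hmp⟩ ⟨ht.1, hrt⟩ (by linarith : 0 ≤ 1 - s) h0.le
          (by ring)).2
      · exact h.rel_mix_of_rel_of_tie hmC ht.1 hp hrt ⟨hmp, hn⟩ h0 h1
    obtain ⟨ε, hε0, hε1, hε⟩ := exists_pos_forall_pos_of_affine (A := -B p m) (B := -B t m)
      (by linarith)
    obtain ⟨ε', hε0', hε1', hε'⟩ := near_generic hp ht htL
    have hs0 : 0 < min ε ε' := lt_min hε0 hε0'
    obtain ⟨hx, hxL⟩ := hε' _ hs0 (min_le_right _ _)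
    have h1 := hall _ hs0 ((min_le_left _ _).trans hε1)
    rw [(hD _ hx hxL m hmC).1] at h1
    have h2 := hε _ hs0.le (min_le_left _ _)
    simp only [map_add, map_smul, LinearMap.add_apply, LinearMap.smul_apply, smul_eq_mul] at h1
    linarith
  by_contra hn
  by_cases hqp : r q p
  · have := h.rel_line_right hq hp hqp (t := 1 / 2) (by norm_num) (by norm_num)
    refine h.asymm _ hp _ hmC hmr ?_
    convert this using 1
    module
  · have := h.tie_segment hp hq ⟨hn, hqp⟩ (s := 0) (t := 1 / 2) le_rfl zero_le_one (by norm_num)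
      (by norm_num)
    refine this.1 ?_
    convert hmr using 1
    · module
    · module

/-- If the form vanished at the pair, it would vanish between the midpoint and both ends. Generic
points near `p` beat the midpoint and those near `q` lose to it, so `B w m` would have both signs.
-/
theorem form_pos_of_rel (h : IsConvexPref (stdSimplex ℝ U) r)
    {B : (U → ℝ) →ₗ[ℝ] (U → ℝ) →ₗ[ℝ] ℝ} {L : (U → ℝ) →ₗ[ℝ] ℝ} (hB : ∀ x y, B x y = -B y x)
    {w : U → ℝ} (hw : w ∈ posSimplex U) (hLw : L w ≠ 0)
    (hD : ∀ w ∈ posSimplex U, L w ≠ 0 → DescribesAt r w (B w)) {p q : U → ℝ}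
    (hp : p ∈ stdSimplex ℝ U) (hq : q ∈ stdSimplex ℝ U) (hpq : r p q) : 0 < B q p := by
  have hmC : (1 / 2 : ℝ) • p + (1 / 2 : ℝ) • q ∈ stdSimplex ℝ U :=
    h.convex hp hq (by norm_num) (by norm_num) (by norm_num)
  have hpp : B p p = 0 := by linarith [hB p p]
  have hqq : B q q = 0 := by linarith [hB q q]
  by_contra hn
  have h0 : B q p = 0 := by
    by_contra hne
    have : B q p < 0 := lt_of_le_of_ne (not_lt.1 hn) hne
    exact h.asymm p hp q hq hpq
      (h.rel_of_form_pos hB hw hLw hD hq hp (by rw [hB]; linarith))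
  have h0' : B p q = 0 := by rw [hB, h0, neg_zero]
  have hpm : B p ((1 / 2 : ℝ) • p + (1 / 2 : ℝ) • q) = 0 := by
    simp [hpp, h0']
  have hqm : B q ((1 / 2 : ℝ) • p + (1 / 2 : ℝ) • q) = 0 := by
    simp [hqq, h0]
  have hr1 : r p ((1 / 2 : ℝ) • p + (1 / 2 : ℝ) • q) := h.rel_midpoint_left hp hq hpq
  have hr2 : r ((1 / 2 : ℝ) • p + (1 / 2 : ℝ) • q) q := by
    have := h.rel_line_right hp hq hpq (t := 1 / 2) (by norm_num) (by norm_num)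
    convert this using 1
    module
  set m := (1 / 2 : ℝ) • p + (1 / 2 : ℝ) • q
  have hw1 : B w m < 0 := by
    obtain ⟨δ, hδ0, -, hδ⟩ := h.upper_near hmC hp hw.1 hr1
    obtain ⟨δ', hδ0', -, hδ'⟩ := near_generic hp hw hLw
    have hs0 : 0 < min δ δ' := lt_min hδ0 hδ0'
    obtain ⟨hx, hxL⟩ := hδ' _ hs0 (min_le_right _ _)
    have h1 := hδ _ hs0.le (min_le_left _ _)
    rw [(hD _ hx hxL m hmC).2] at h1
    simp only [map_add, map_smul, LinearMap.add_apply, LinearMap.smul_apply, smul_eq_mul, hpm,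
      mul_zero, zero_add] at h1
    by_contra hn
    linarith [mul_nonneg hs0.le (not_lt.1 hn)]
  have hw2 : 0 < B w m := by
    obtain ⟨δ, hδ0, -, hδ⟩ := h.lower_near hmC hq hw.1 hr2
    obtain ⟨δ', hδ0', -, hδ'⟩ := near_generic hq hw hLw
    have hs0 : 0 < min δ δ' := lt_min hδ0 hδ0'
    obtain ⟨hx, hxL⟩ := hδ' _ hs0 (min_le_right _ _)
    have h1 := hδ _ hs0.le (min_le_left _ _)
    rw [(hD _ hx hxL m hmC).1] at h1
    simp only [map_add, map_smul, LinearMap.add_apply, LinearMap.smul_apply, smul_eq_mul, hqm,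
      mul_zero, zero_add] at h1
    exact pos_of_mul_pos_right h1 hs0.le
  linarith

/-- Fishburn's representation theorem, on the simplex. -/
theorem exists_skew_bilinear (h : IsConvexPref (stdSimplex ℝ U) r) :
    ∃ B : (U → ℝ) →ₗ[ℝ] (U → ℝ) →ₗ[ℝ] ℝ, (∀ x y, B x y = -B y x) ∧
      ∀ p ∈ stdSimplex ℝ U, ∀ q ∈ stdSimplex ℝ U, r p q ↔ 0 < B p q := by
  by_cases hne : ∃ p ∈ stdSimplex ℝ U, ∃ q ∈ stdSimplex ℝ U, r p q
  · obtain ⟨p, hp, q, hq, hr⟩ := hne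
    obtain ⟨B, L, hB, ⟨w, hw, hLw⟩, hD⟩ := h.exists_skew_on_dense hp hq hr
    -- Describing functionals take the reference point as first argument, whereas the representation
    -- takes the preferred point first.
    refine ⟨B.flip, fun x y => hB y x, fun p hp q hq => ?_⟩
    exact ⟨h.form_pos_of_rel hB hw hLw hD hp hq, h.rel_of_form_pos hB hw hLw hD hp hq⟩
  · push Not at hne
    exact ⟨0, by simp, fun p hp q hq => by simpa using hne p hp q hq⟩

end IsConvexPref

end Representation

/-! ### Uniqueness: skew forms with equal signs are proportional. -/

section Proportional

variable {V : Type*} [Fintype V] {B B' : (V → ℝ) →ₗ[ℝ] (V → ℝ) →ₗ[ℝ] ℝ}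

/-- Skew-symmetric forms with the same sign on all pairs of outcomes. -/
structure SameSign (B B' : (V → ℝ) →ₗ[ℝ] (V → ℝ) →ₗ[ℝ] ℝ) : Prop where
  skew : ∀ x y, B x y = -B y x
  skew' : ∀ x y, B' x y = -B' y x
  pos_iff : ∀ p ∈ stdSimplex ℝ V, ∀ q ∈ stdSimplex ℝ V, 0 < B p q ↔ 0 < B' p q

namespace SameSign

theorem eq_zero_iff (h : SameSign B B') {p q : V → ℝ} (hp : p ∈ stdSimplex ℝ V)
    (hq : q ∈ stdSimplex ℝ V) : B p q = 0 ↔ B' p q = 0 := by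
  have h1 := h.pos_iff p hp q hq
  have h2 := h.pos_iff q hq p hp
  rw [h.skew q p, h.skew' q p] at h2
  constructor <;> intro h3 <;> rw [h3] at h1 h2 <;> simp at h1 h2 <;> linarith

/-- The mixture of `p` and `l` at which `B'` vanishes against `q` is also a zero of `B`; this
equates the two ratios. -/
theorem cross (h : SameSign B B') {p l q : V → ℝ} (hp : p ∈ stdSimplex ℝ V)
    (hl : l ∈ stdSimplex ℝ V) (hq : q ∈ stdSimplex ℝ V) (h1 : 0 ≤ B' p q) (h2 : B' l q < 0) :
    B p q * B' l q = B l q * B' p q := by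
  have hd : 0 < B' p q - B' l q := by linarith
  have hm := convex_stdSimplex ℝ V hp hl (a := -B' l q / (B' p q - B' l q))
    (b := B' p q / (B' p q - B' l q)) (div_nonneg (by linarith) hd.le) (div_nonneg h1 hd.le)
    (by field_simp; ring)
  have hz := h.eq_zero_iff hm hq
  simp only [map_add, map_smul, LinearMap.add_apply, LinearMap.smul_apply, smul_eq_mul] at hz
  have h3 := hz.2 (by field_simp; ring)
  field_simp at h3
  linarith

theorem exists_ratio_at (h : SameSign B B') {q : V → ℝ} (hq : q ∈ posSimplex V) :
    ∃ c : ℝ, 0 < c ∧ ∀ p ∈ stdSimplex ℝ V, B p q = c * B' p q := by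
  by_cases hne : ∃ p ∈ stdSimplex ℝ V, B' p q ≠ 0
  · obtain ⟨p₀, hp₀, hn⟩ := hne
    have hqq : B' q q = 0 := by linarith [h.skew' q q]
    -- Reflecting `p₀` in the full-support point `q` provides an opposite sign, so every `p` can be
    -- compared through `cross` with a point of the other sign.
    have hv : ∑ a, (q - p₀) a = 0 := by simp [Finset.sum_sub_distrib, hq.1.2, hp₀.2]
    obtain ⟨β, hβ, hm⟩ := posSimplex_move hq hv
    have hC := (hm β (abs_of_pos hβ).le).1
    have hval : B' (q + β • (q - p₀)) q = -(β * B' p₀ q) := by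
      simp only [map_add, map_smul, map_sub, LinearMap.add_apply, LinearMap.smul_apply,
        LinearMap.sub_apply, smul_eq_mul, hqq]
      ring
    obtain ⟨u, hu, l, hl, hu0, hl0⟩ : ∃ u ∈ stdSimplex ℝ V, ∃ l ∈ stdSimplex ℝ V,
        0 < B' u q ∧ B' l q < 0 := by
      rcases lt_or_gt_of_ne hn with h1 | h1
      · exact ⟨_, hC, p₀, hp₀, by rw [hval]; nlinarith, h1⟩
      · exact ⟨p₀, hp₀, _, hC, h1, by rw [hval]; nlinarith⟩
    have hul := h.cross hu hl hq.1 hu0.le hl0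
    refine ⟨B u q / B' u q, div_pos ((h.pos_iff u hu q hq.1).2 hu0) hu0, fun p hp => ?_⟩
    rw [div_mul_eq_mul_div, eq_div_iff hu0.ne']
    rcases le_or_gt 0 (B' p q) with h1 | h1
    · have := h.cross hp hl hq.1 h1 hl0
      apply mul_right_cancel₀ hl0.ne
      linear_combination B' u q * this - B' p q * hul
    · linear_combination -h.cross hu hp hq.1 hu0.le h1
  · push Not at hne
    exact ⟨1, one_pos, fun p hp => by rw [hne p hp, (h.eq_zero_iff hp hq.1).2 (hne p hp)]; simp⟩

theorem exists_pos_pair {p₀ q₀ : V → ℝ} (hp₀ : p₀ ∈ stdSimplex ℝ V) (hq₀ : q₀ ∈ stdSimplex ℝ V)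
    (hpos : 0 < B' p₀ q₀) : ∃ e ∈ posSimplex V, ∃ e' ∈ posSimplex V, 0 < B' e e' := by
  have hne : Nonempty V := by
    by_contra hne
    rw [not_nonempty_iff] at hne
    have := hp₀.2
    simp at this
  obtain ⟨w, hw⟩ := posSimplex_nonempty (U := V)
  obtain ⟨δ, h0, h1, h2⟩ := exists_pos_forall_pos_of_affine (A := B' p₀ q₀) (B := B' p₀ w) hpos
  have h3 := h2 δ h0.le le_rfl
  have hq := posSimplex_line hq₀ hw h0 h1
  have h4 : 0 < B' p₀ ((1 - δ) • q₀ + δ • w) := by simpa using h3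
  obtain ⟨ε, h5, h6, h7⟩ := exists_pos_forall_pos_of_affine
    (B := B' w ((1 - δ) • q₀ + δ • w)) h4
  have h8 := h7 ε h5.le le_rfl
  refine ⟨_, posSimplex_line hp₀ hw h5 h6, _, hq, ?_⟩
  rw [map_add B', map_smul, map_smul]
  exact h8

/-- Skew-symmetric forms with the same signs are proportional. -/
theorem proportional (h : SameSign B B') :
    ∃ c : ℝ, 0 < c ∧ ∀ p ∈ stdSimplex ℝ V, ∀ q ∈ stdSimplex ℝ V, B p q = c * B' p q := by
  by_cases hne : ∃ p ∈ stdSimplex ℝ V, ∃ q ∈ stdSimplex ℝ V, 0 < B' p q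
  · obtain ⟨p₀, hp₀, q₀, hq₀, hpos⟩ := hne
    obtain ⟨e, he, e', he', hee⟩ := exists_pos_pair hp₀ hq₀ hpos
    obtain ⟨c, hc, hce⟩ := h.exists_ratio_at he
    obtain ⟨c', hc', hce'⟩ := h.exists_ratio_at he'
    have hcc : c' = c := by
      have h1 := hce e' he'.1
      have h2 := hce' e he.1
      rw [h.skew, h.skew' e'] at h1
      apply mul_right_cancel₀ hee.ne'
      linarith
    subst hcc
    -- The ratio passes from one full-support point to any other that is comparable with it.
    have hcomp : ∀ q ∈ posSimplex V, ∀ f ∈ posSimplex V, B' q f ≠ 0 →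
        (∀ p ∈ stdSimplex ℝ V, B p f = c' * B' p f) →
        ∀ p ∈ stdSimplex ℝ V, B p q = c' * B' p q := by
      intro q hq f hf hqf hcf
      obtain ⟨d, hd, hdq⟩ := h.exists_ratio_at hq
      have : d = c' := by
        have h1 := hdq f hf.1
        have h2 := hcf q hq.1
        rw [h.skew, h.skew' f] at h1
        apply mul_right_cancel₀ hqf
        linarith
      rw [← this]; exact hdq
    have hmidC : ∀ q ∈ stdSimplex ℝ V, (1 / 2 : ℝ) • q + (1 / 2 : ℝ) • e ∈ posSimplex V := by
      intro q hq
      have := posSimplex_line hq he (t := 1 / 2) (by norm_num) (by norm_num)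
      convert this using 3
      norm_num
    have hmid : ∀ q, (∀ p ∈ stdSimplex ℝ V, B p ((1 / 2 : ℝ) • q + (1 / 2 : ℝ) • e) =
        c' * B' p ((1 / 2 : ℝ) • q + (1 / 2 : ℝ) • e)) →
        ∀ p ∈ stdSimplex ℝ V, B p q = c' * B' p q := by
      intro q hq p hp
      have h1 := hq p hp
      simp only [map_add, map_smul, smul_eq_mul] at h1
      linear_combination 2 * h1 - hce p hp
    -- If `q` is tied with `e'`, its midpoint with `e` is not, as `e` beats `e'`; the ratio at the
    -- midpoint and at `e` gives the one at `q`.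
    have hposq : ∀ q ∈ posSimplex V, ∀ p ∈ stdSimplex ℝ V, B p q = c' * B' p q := by
      intro q hq
      by_cases h1 : B' q e' = 0
      · refine hmid q (hcomp _ (hmidC q hq.1) e' he' ?_ hce')
        simp only [map_add, map_smul, LinearMap.add_apply, LinearMap.smul_apply, smul_eq_mul, h1]
        have := hee.ne'
        simpa using this
      · exact hcomp q hq e' he' h1 hce'
    exact ⟨c', hc', fun p hp q hq => hmid q (hposq _ (hmidC q hq)) p hp⟩
  · push Not at hne
    refine ⟨1, one_pos, fun p hp q hq => ?_⟩
    have h1 := hne p hp q hq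
    have h2 := hne q hq p hp
    rw [h.skew'] at h2
    have h3 : B' p q = 0 := by linarith
    rw [h3, (h.eq_zero_iff hp hq).2 h3]; simp

end SameSign

end Proportional

/-! ### Translation between preferences, SSB functions and matrices. -/

section Forms

variable {U : Type*} [Fintype U]

/-- A preference relation as a relation on vectors. -/
def vectorRel (r : Pref U) (x y : U → ℝ) : Prop :=
  ∃ (hx : x ∈ stdSimplex ℝ U) (hy : y ∈ stdSimplex ℝ U), r ⟨x, hx⟩ ⟨y, hy⟩

theorem vectorRel_coe (r : Pref U) (p q : Outcome U) : vectorRel r p.1 q.1 ↔ r p q :=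
  ⟨fun ⟨_, _, h⟩ => h, fun h => ⟨p.2, q.2, h⟩⟩

theorem tie_vectorRel (r : Pref U) (p q : Outcome U) :
    Tie (vectorRel r) p.1 q.1 ↔ Indiff r p q := by
  simp only [Tie, Indiff, vectorRel_coe]

theorem convex_of_convexOutcomes {S : Set (Outcome U)} (hS : ConvexOutcomes S) {T : Set (U → ℝ)}
    (hT : ∀ x, x ∈ T ↔ ∃ hx : x ∈ stdSimplex ℝ U, (⟨x, hx⟩ : Outcome U) ∈ S) : Convex ℝ T := by
  have : T = Subtype.val '' S := by
    ext x
    rw [hT]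
    constructor
    · rintro ⟨hx, h⟩; exact ⟨_, h, rfl⟩
    · rintro ⟨y, h, rfl⟩; exact ⟨y.2, h⟩
  rw [this]; exact hS

theorem eventually_of_isOpen {S : Set (Outcome U)} (hS : IsOpen S) {P : (U → ℝ) → Prop}
    (hP : ∀ x : Outcome U, x ∈ S → P x.1) {q : U → ℝ} (hq : q ∈ stdSimplex ℝ U)
    (hqS : (⟨q, hq⟩ : Outcome U) ∈ S) : ∀ᶠ x in 𝓝[stdSimplex ℝ U] q, P x := by
  have h1 : ∀ᶠ x : Outcome U in 𝓝 ⟨q, hq⟩, P x.1 := by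
    filter_upwards [hS.mem_nhds hqS] with x hx using hP x hx
  rw [nhdsWithin_eq_map_subtype_coe hq, Filter.eventually_map]
  exact h1

theorem isConvexPref_vectorRel {r : Pref U} (hr : r ∈ allPrefs U) :
    IsConvexPref (stdSimplex ℝ U) (vectorRel r) := by
  obtain ⟨hasym, hcont, hconv, hsymm⟩ := hr
  refine ⟨convex_stdSimplex ℝ U, ?_, ?_, ?_, ?_, ?_, ?_, ?_, ?_⟩
  · rintro x hx y hy ⟨_, _, h1⟩ ⟨_, _, h2⟩
    exact hasym _ _ h1 h2
  · rintro p hp q hq ⟨_, _, h⟩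
    exact eventually_of_isOpen (hcont ⟨p, hp⟩).1 (fun x hx => ⟨x.2, hp, hx⟩) hq h
  · rintro p hp q hq ⟨_, _, h⟩
    exact eventually_of_isOpen (hcont ⟨p, hp⟩).2 (fun x hx => ⟨hp, x.2, hx⟩) hq h
  · intro p hp
    refine convex_of_convexOutcomes (hconv ⟨p, hp⟩).1 fun x => ?_
    exact ⟨fun ⟨hx, _, _, h⟩ => ⟨hx, h⟩, fun ⟨hx, h⟩ => ⟨hx, hx, hp, h⟩⟩
  · intro p hp
    refine convex_of_convexOutcomes (hconv ⟨p, hp⟩).2.1 fun x => ?_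
    exact ⟨fun ⟨hx, _, _, h⟩ => ⟨hx, h⟩, fun ⟨hx, h⟩ => ⟨hx, hp, hx, h⟩⟩
  · intro p hp
    refine convex_of_convexOutcomes (hconv ⟨p, hp⟩).2.2.1 fun x => ?_
    constructor
    · rintro ⟨hx, h⟩
      have h' : ¬ r ⟨p, hp⟩ ⟨x, hx⟩ := fun h1 => h ⟨hp, hx, h1⟩
      by_cases h2 : r ⟨x, hx⟩ ⟨p, hp⟩
      · exact ⟨hx, Or.inl h2⟩
      · exact ⟨hx, Or.inr ⟨h', h2⟩⟩
    · rintro ⟨hx, h | h⟩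
      · exact ⟨hx, fun ⟨_, _, h1⟩ => hasym _ _ h h1⟩
      · exact ⟨hx, fun ⟨_, _, h1⟩ => h.1 h1⟩
  · intro p hp
    refine convex_of_convexOutcomes (hconv ⟨p, hp⟩).2.2.2 fun x => ?_
    constructor
    · rintro ⟨hx, h⟩
      have h' : ¬ r ⟨x, hx⟩ ⟨p, hp⟩ := fun h1 => h ⟨hx, hp, h1⟩
      by_cases h2 : r ⟨p, hp⟩ ⟨x, hx⟩
      · exact ⟨hx, Or.inl h2⟩
      · exact ⟨hx, Or.inr ⟨h2, h'⟩⟩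
    · rintro ⟨hx, h | h⟩
      · exact ⟨hx, fun ⟨_, _, h1⟩ => hasym _ _ h h1⟩
      · exact ⟨hx, fun ⟨_, _, h1⟩ => h.2 h1⟩
  · intro p hp q hq s hs t h0 h1 h2 h3
    have hval : ∀ a b : Outcome U,
        (1 / 2 : ℝ) • a.1 + (1 / 2 : ℝ) • b.1 = (mid a b).1 := by
      intro a b
      simp only [mid, mix]
      norm_num
    have key := hsymm ⟨p, hp⟩ ⟨q, hq⟩ ⟨s, hs⟩ t h0 h1
    rw [← tie_vectorRel, ← tie_vectorRel, ← tie_vectorRel, ← hval, ← hval, ← hval] at key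
    exact key h2 h3

variable [DecidableEq U]

/-- The bilinear form of a matrix. -/
noncomputable def form (A : Matrix U U ℝ) : (U → ℝ) →ₗ[ℝ] (U → ℝ) →ₗ[ℝ] ℝ :=
  Matrix.toLinearMap₂' ℝ A

theorem form_apply (A : Matrix U U ℝ) (p q : U → ℝ) :
    form A p q = ∑ x, ∑ y, p x * (q y * A x y) := by
  simp only [form, Matrix.toLinearMap₂'_apply, smul_eq_mul]

@[simp]
theorem form_single (A : Matrix U U ℝ) (x y : U) :
    form A (Pi.single x 1) (Pi.single y 1) = A x y := by
  simp [form_apply, Pi.single_apply]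

theorem form_skew {A : Matrix U U ℝ} (hA : ∀ x y, A x y = -A y x) (p q : U → ℝ) :
    form A p q = -form A q p := by
  rw [form_apply, form_apply, Finset.sum_comm, ← Finset.sum_neg_distrib]
  refine Finset.sum_congr rfl fun x _ => ?_
  rw [← Finset.sum_neg_distrib]
  refine Finset.sum_congr rfl fun y _ => ?_
  rw [hA y x]; ring

/-- Fishburn's representation theorem, in terms of matrices. -/
theorem exists_matrix_of_mem_allPrefs {r : Pref U} (hr : r ∈ allPrefs U) :
    ∃ A : Matrix U U ℝ, (∀ x y, A x y = -A y x) ∧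
      ∀ p q : Outcome U, r p q ↔ 0 < form A p.1 q.1 := by
  obtain ⟨B, hB, hrep⟩ := (isConvexPref_vectorRel hr).exists_skew_bilinear
  refine ⟨LinearMap.toMatrix₂' ℝ B, fun x y => ?_, fun p q => ?_⟩
  · simp only [LinearMap.toMatrix₂'_apply]
    exact hB _ _
  · rw [form, Matrix.toLinearMap₂'_toMatrix', ← hrep p.1 p.2 q.1 q.2, vectorRel_coe]

/-- An affine function is both convex and concave on the simplex, so Jensen's inequality holds in
both directions. The value zero off the simplex is irrelevant. -/
theorem eq_sum_of_affine {f : Outcome U → ℝ}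
    (hf : ∀ (t : ℝ) (h0 : 0 ≤ t) (h1 : t ≤ 1) (p q : Outcome U),
      f (mix t h0 h1 p q) = t * f p + (1 - t) * f q) (p : Outcome U) :
    f p = ∑ x, p.1 x * f (pureOutcome x) := by
  classical
  let F : (U → ℝ) → ℝ := fun x => if h : x ∈ stdSimplex ℝ U then f ⟨x, h⟩ else 0
  have hF : ∀ q : Outcome U, F q.1 = f q := fun q => dif_pos q.2
  have hmix : ∀ x ∈ stdSimplex ℝ U, ∀ y ∈ stdSimplex ℝ U, ∀ a b : ℝ, 0 ≤ a → 0 ≤ b →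
      a + b = 1 → F (a • x + b • y) = a • F x + b • F y := by
    intro x hx y hy a b ha hb hab
    obtain rfl : b = 1 - a := by linarith
    have := hf a ha (by linarith) ⟨x, hx⟩ ⟨y, hy⟩
    rw [← hF, ← hF, ← hF] at this
    exact this
  have hcv : ConvexOn ℝ (stdSimplex ℝ U) F :=
    ⟨convex_stdSimplex ℝ U, fun x hx y hy a b ha hb hab => (hmix x hx y hy a b ha hb hab).le⟩
  have hcc : ConcaveOn ℝ (stdSimplex ℝ U) F :=
    ⟨convex_stdSimplex ℝ U, fun x hx y hy a b ha hb hab => (hmix x hx y hy a b ha hb hab).ge⟩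
  have hp : ∑ x, p.1 x • (Pi.single x 1 : U → ℝ) = p.1 := by
    ext a
    simp [Finset.sum_apply, Pi.single_apply]
  have h1 := hcv.map_sum_le (t := Finset.univ) (w := p.1) (p := fun x => Pi.single x 1)
    (fun x _ => p.2.1 x) p.2.2 (fun x _ => (pureOutcome x).2)
  have h2 := hcc.le_map_sum (t := Finset.univ) (w := p.1) (p := fun x => Pi.single x 1)
    (fun x _ => p.2.1 x) p.2.2 (fun x _ => (pureOutcome x).2)
  rw [hp, hF] at h1 h2
  have h3 : ∀ x : U, F (Pi.single x 1) = f (pureOutcome x) := fun x => hF (pureOutcome x)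
  simp only [h3, smul_eq_mul] at h1 h2
  exact le_antisymm h1 h2

/-- An SSB function is the bilinear form of its values at pure outcomes. -/
theorem IsSSB.eq_form {φ : Outcome U → Outcome U → ℝ} (hφ : IsSSB φ) (p q : Outcome U) :
    φ p q = form (Matrix.of fun x y => φ (pureOutcome x) (pureOutcome y)) p.1 q.1 := by
  rw [form_apply, eq_sum_of_affine (f := fun p => φ p q)
    (fun t h0 h1 a b => hφ.linear_left t h0 h1 a b q) p]
  refine Finset.sum_congr rfl fun x _ => ?_
  simp only [Matrix.of_apply]
  rw [eq_sum_of_affine (f := φ (pureOutcome x))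
    (fun t h0 h1 a b => hφ.linear_right t h0 h1 a b _) q, Finset.mul_sum]

/-- Relations that are represented by matrices and agree on the outcomes in `X` have proportional
matrices on `X`. -/
theorem exists_proportional_on {A A' : Matrix U U ℝ} (hA : ∀ x y, A x y = -A y x)
    (hA' : ∀ x y, A' x y = -A' y x) (X : Finset U)
    (h : ∀ p ∈ outcomesOn (X : Set U), ∀ q ∈ outcomesOn (X : Set U),
      (0 < form A p.1 q.1 ↔ 0 < form A' p.1 q.1)) :
    ∃ c : ℝ, 0 < c ∧ ∀ x ∈ X, ∀ y ∈ X, A x y = c * A' x y := by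
  classical
  -- The face spanned by `X` is itself a simplex; the forms are pulled back to it so that
  -- `SameSign.proportional` applies there.
  let ι : (X → ℝ) →ₗ[ℝ] (U → ℝ) := Fintype.linearCombination ℝ (fun v : X => Pi.single v.1 1)
  have hι : ∀ p : X → ℝ, ι p = ∑ v, p v • (Pi.single v.1 1 : U → ℝ) := fun p => rfl
  have hιC : ∀ p ∈ stdSimplex ℝ X, ι p ∈ stdSimplex ℝ U := by
    intro p hp
    rw [hι]
    exact (convex_stdSimplex ℝ U).sum_mem (fun v _ => hp.1 v) hp.2
      (fun v _ => (pureOutcome v.1).2)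
  have hιX : ∀ p : X → ℝ, ∀ a, a ∉ (X : Set U) → ι p a = 0 := by
    intro p a ha
    rw [hι, Finset.sum_apply]
    refine Finset.sum_eq_zero fun v _ => ?_
    have : a ≠ v.1 := fun e => ha (by rw [e]; exact v.2)
    simp [this]
  have hιs : ∀ v : X, ι (Pi.single v 1) = Pi.single v.1 1 := by
    intro v
    simp [ι]
  have hS : SameSign ((form A).compl₁₂ ι ι) ((form A').compl₁₂ ι ι) := by
    refine ⟨fun x y => form_skew hA _ _, fun x y => form_skew hA' _ _, fun p hp q hq => ?_⟩
    exact h ⟨ι p, hιC p hp⟩ (hιX p) ⟨ι q, hιC q hq⟩ (hιX q)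
  obtain ⟨c, hc, hcp⟩ := hS.proportional
  refine ⟨c, hc, fun x hx y hy => ?_⟩
  have := hcp (Pi.single ⟨x, hx⟩ 1) (single_mem_stdSimplex ℝ _) (Pi.single ⟨y, hy⟩ 1)
    (single_mem_stdSimplex ℝ _)
  simpa [hιs] using this

/-- The comparisons of pure outcomes, as a matrix with entries `1`, `0`, `-1`. -/
noncomputable def prefMatrix (r : Pref U) : Matrix U U ℝ := fun x y =>
  open Classical in
  if r (pureOutcome x) (pureOutcome y) then 1
  else if r (pureOutcome y) (pureOutcome x) then -1 else 0

theorem IsSSB.prefMatrix_eq {r : Pref U} {φ : Outcome U → Outcome U → ℝ} (hφ : IsSSB φ)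
    (hval : ∀ a b : U, φ (pureOutcome a) (pureOutcome b) = -1 ∨
      φ (pureOutcome a) (pureOutcome b) = 0 ∨ φ (pureOutcome a) (pureOutcome b) = 1)
    (hr : Represents φ r) (x y : U) :
    prefMatrix r x y = φ (pureOutcome x) (pureOutcome y) := by
  have h1 := hr (pureOutcome x) (pureOutcome y)
  have h2 := hr (pureOutcome y) (pureOutcome x)
  rw [hφ.skew (pureOutcome y)] at h2
  rw [prefMatrix, h1, h2]
  rcases hval x y with h | h | h <;> rw [h] <;> norm_num

theorem rel_iff_form_prefMatrix {r : Pref U} (hr : r ∈ pcPrefs U) (p q : Outcome U) :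
    r p q ↔ 0 < form (prefMatrix r) p.1 q.1 := by
  obtain ⟨-, φ, hφ, hrep⟩ := hr
  rw [hrep p q, hφ.1.1.eq_form]
  have : (Matrix.of fun x y => φ (pureOutcome x) (pureOutcome y)) = prefMatrix r := by
    ext x y; exact (hφ.1.1.prefMatrix_eq hφ.2 hrep x y).symm
  rw [this]

theorem prefMatrix_skew {r : Pref U} (hr : AsymmPref r) (x y : U) :
    prefMatrix r x y = -prefMatrix r y x := by
  simp only [prefMatrix]
  have h1 := hr (pureOutcome x) (pureOutcome y)
  by_cases h2 : r (pureOutcome x) (pureOutcome y)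
  · simp [h2, h1 h2]
  · by_cases h3 : r (pureOutcome y) (pureOutcome x) <;> simp [h2, h3]

/-- Normalized SSB functions that represent the same relation are equal. -/
theorem normalizedSSB_unique {r : Pref U} {φ ψ : Outcome U → Outcome U → ℝ}
    (hφ : φ ∈ normalizedSSB U) (hψ : ψ ∈ normalizedSSB U) (hφr : Represents φ r)
    (hψr : Represents ψ r) (p q : Outcome U) : φ p q = ψ p q := by
  have hS : SameSign (form (Matrix.of fun x y => φ (pureOutcome x) (pureOutcome y)))
      (form (Matrix.of fun x y => ψ (pureOutcome x) (pureOutcome y))) := by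
    refine ⟨form_skew fun _ _ => hφ.1.skew _ _, form_skew fun _ _ => hψ.1.skew _ _,
      fun p hp q hq => ?_⟩
    rw [← hφ.1.eq_form ⟨p, hp⟩ ⟨q, hq⟩, ← hψ.1.eq_form ⟨p, hp⟩ ⟨q, hq⟩, ← hφr, ← hψr]
  obtain ⟨c, hc, hcp⟩ := hS.proportional
  have hcp' : ∀ p q : Outcome U, φ p q = c * ψ p q := fun p q => by
    rw [hφ.1.eq_form, hψ.1.eq_form]; exact hcp p.1 p.2 q.1 q.2
  rcases hψ.2 with h0 | hψ1
  · rw [hcp', h0, mul_zero]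
  rcases hφ.2 with h0 | hφ1
  · have := hcp' p q
    rw [h0] at this ⊢
    rcases mul_eq_zero.1 this.symm with h | h
    · exact absurd h hc.ne'
    · exact h.symm
  obtain ⟨p₁, q₁, h1⟩ := hφ1.1
  obtain ⟨p₂, q₂, h2⟩ := hψ1.1
  have h3 : ψ p₁ q₁ ≤ 1 := hψ1.2 ⟨p₁, q₁, rfl⟩
  have h4 : φ p₂ q₂ ≤ 1 := hφ1.2 ⟨p₂, q₂, rfl⟩
  rw [hcp'] at h1 h4
  rw [h2] at h4
  -- Both functions have largest value one: evaluating at the maximizer of `φ` gives `1 ≤ c`, at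
  -- that of `ψ` it gives `c ≤ 1`.
  have : c = 1 := by nlinarith
  rw [hcp', this, one_mul]

/-- Uniqueness of the normalized representation makes the utilitarian claim for arbitrary normalized
functions a claim about comparison matrices. -/
theorem normalized_eq_form_prefMatrix {r : Pref U} (hr : r ∈ pcPrefs U)
    {φ : Outcome U → Outcome U → ℝ} (hφ : φ ∈ normalizedSSB U) (hφr : Represents φ r)
    (p q : Outcome U) : φ p q = form (prefMatrix r) p.1 q.1 := by
  obtain ⟨-, ψ, hψ, hrep⟩ := hr
  rw [normalizedSSB_unique hφ hψ.1 hφr hrep, hψ.1.1.eq_form]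
  have : (Matrix.of fun x y => ψ (pureOutcome x) (pureOutcome y)) = prefMatrix r := by
    ext x y; exact (hψ.1.1.prefMatrix_eq hψ.2 hrep x y).symm
  rw [this]

end Forms

/-! ### Aggregation of matrices: social comparisons in units of a common worst alternative. -/

theorem agree_triple {U : Type*} [DecidableEq U] {A A' : Matrix U U ℝ} (hA : ∀ x y, A x y = -A y x)
    (hA' : ∀ x y, A' x y = -A' y x) {x y z : U} (h1 : A x y = A' x y) (h2 : A x z = A' x z)
    (h3 : A y z = A' y z) : ∀ s ∈ ({x, y, z} : Finset U), ∀ t ∈ ({x, y, z} : Finset U),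
      A s t = A' s t := by
  have hd : ∀ s, A s s = A' s s := fun s => by
    have := hA s s
    have := hA' s s
    linarith
  have hs : ∀ {s t}, A s t = A' s t → A t s = A' t s := fun {s t} h => by
    rw [hA, hA', h]
  intro s hsX t htX
  simp only [Finset.mem_insert, Finset.mem_singleton] at hsX htX
  rcases hsX with rfl | rfl | rfl <;> rcases htX with rfl | rfl | rfl
  exacts [hd _, h1, h2, hs h1, hd _, h3, hs h2, hs h3, hd _]

section MatrixAggregation

variable {U : Type*} [Fintype U] [DecidableEq U] {N : Type*}

/-- The matrix form of an Arrovian social welfare function `Φ` on a rich domain `𝓜` of pairwise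
comparison matrices. -/
structure MatrixAggregation (𝓜 : Set (Matrix U U ℝ))
    (Φ : (N → Matrix U U ℝ) → Matrix U U ℝ) : Prop where
  skew : ∀ A ∈ 𝓜, ∀ x y, A x y = -A y x
  values : ∀ A ∈ 𝓜, ∀ x y, A x y = -1 ∨ A x y = 0 ∨ A x y = 1
  zero_mem : 0 ∈ 𝓜
  neg_mem : ∀ A ∈ 𝓜, -A ∈ 𝓜
  bottom : ∀ A ∈ 𝓜, ∀ X : Finset U, X.card ≤ 4 → ∀ b ∉ X, ∃ A' ∈ 𝓜,
    (∀ x ∈ X, ∀ y ∈ X, A' x y = A x y) ∧ ∀ x ∈ X, A' x b = 1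
  social_skew : ∀ m, (∀ i, m i ∈ 𝓜) → ∀ x y, Φ m x y = -Φ m y x
  pareto : ∀ m, (∀ i, m i ∈ 𝓜) → ∀ p ∈ stdSimplex ℝ U, ∀ q ∈ stdSimplex ℝ U,
    (∀ i, 0 ≤ form (m i) p q) →
      0 ≤ form (Φ m) p q ∧ ((∃ i, 0 < form (m i) p q) → 0 < form (Φ m) p q)
  iia : ∀ m m', (∀ i, m i ∈ 𝓜) → (∀ i, m' i ∈ 𝓜) → ∀ X : Finset U,
    (∀ i, ∀ x ∈ X, ∀ y ∈ X, m i x y = m' i x y) →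
      ∃ c : ℝ, 0 < c ∧ ∀ x ∈ X, ∀ y ∈ X, Φ m x y = c * Φ m' x y

/-- In the profile `m`, the comparisons of `x` and `y` are given by `v`, and everyone puts the
alternative `b` below `x` and `y`. -/
structure Fits (𝓜 : Set (Matrix U U ℝ)) (m : N → Matrix U U ℝ) (v : N → ℝ) (x y b : U) :
    Prop where
  mem : ∀ i, m i ∈ 𝓜
  pair : ∀ i, m i x y = v i
  left : ∀ i, m i x b = 1
  right : ∀ i, m i y b = 1

theorem mix_two_mem {α β : ℝ} (h1 : 0 ≤ α) (h2 : 0 ≤ β) (h : α + β = 1) (x y : U) :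
    α • (Pi.single x 1 : U → ℝ) + β • (Pi.single y 1 : U → ℝ) ∈ stdSimplex ℝ U :=
  convex_stdSimplex ℝ U (single_mem_stdSimplex ℝ x) (single_mem_stdSimplex ℝ y) h1 h2 h

theorem mix_three_mem {α β γ : ℝ} (h1 : 0 ≤ α) (h2 : 0 ≤ β) (h3 : 0 ≤ γ) (h : α + β + γ = 1)
    (x y z : U) : α • (Pi.single x 1 : U → ℝ) + β • (Pi.single y 1 : U → ℝ) +
      γ • (Pi.single z 1 : U → ℝ) ∈ stdSimplex ℝ U := by
  refine ⟨fun a => ?_, ?_⟩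
  · simp only [Pi.add_apply, Pi.smul_apply, smul_eq_mul]
    have e : ∀ s : U, 0 ≤ (Pi.single s 1 : U → ℝ) a := fun s => (single_mem_stdSimplex ℝ s).1 a
    have := e x
    have := e y
    have := e z
    positivity
  · simp [Finset.sum_add_distrib, ← Finset.mul_sum, h]

/-- With five alternatives, four can be in play and one is still free to be put below, or above, all
of them. -/
theorem exists_fresh (hU : 5 ≤ Fintype.card U) {X : Finset U} (hX : X.card ≤ 4) : ∃ b, b ∉ X := by
  by_contra hn
  push Not at hn
  have : X = Finset.univ := Finset.eq_univ_iff_forall.2 hn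
  rw [this, Finset.card_univ] at hX
  omega

namespace MatrixAggregation

variable {𝓜 : Set (Matrix U U ℝ)} {Φ : (N → Matrix U U ℝ) → Matrix U U ℝ}

theorem diag (h : MatrixAggregation 𝓜 Φ) {A : Matrix U U ℝ} (hA : A ∈ 𝓜) (x : U) :
    A x x = 0 := by
  linarith [h.skew A hA x x]

theorem social_diag (h : MatrixAggregation 𝓜 Φ) {m : N → Matrix U U ℝ} (hm : ∀ i, m i ∈ 𝓜)
    (x : U) : Φ m x x = 0 := by
  linarith [h.social_skew m hm x x]

theorem top (h : MatrixAggregation 𝓜 Φ) {A : Matrix U U ℝ} (hA : A ∈ 𝓜) {X : Finset U}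
    (hX : X.card ≤ 4) {b : U} (hb : b ∉ X) :
    ∃ A' ∈ 𝓜, (∀ x ∈ X, ∀ y ∈ X, A' x y = A x y) ∧ ∀ x ∈ X, A' b x = 1 := by
  obtain ⟨A', hA', h1, h2⟩ := h.bottom (-A) (h.neg_mem A hA) X hX b hb
  refine ⟨-A', h.neg_mem A' hA', fun x hx y hy => ?_, fun x hx => ?_⟩
  · rw [Matrix.neg_apply, h1 x hx y hy, Matrix.neg_apply, neg_neg]
  · rw [Matrix.neg_apply, ← h.skew A' hA', h2 x hx]

theorem bottom_profile (h : MatrixAggregation 𝓜 Φ) {m : N → Matrix U U ℝ} (hm : ∀ i, m i ∈ 𝓜)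
    {X : Finset U} (hX : X.card ≤ 4) {b : U} (hb : b ∉ X) :
    ∃ m' : N → Matrix U U ℝ, (∀ i, m' i ∈ 𝓜) ∧
      (∀ i, ∀ x ∈ X, ∀ y ∈ X, m' i x y = m i x y) ∧ ∀ i, ∀ x ∈ X, m' i x b = 1 := by
  choose m' h1 h2 h3 using fun i => h.bottom (m i) (hm i) X hX b hb
  exact ⟨m', h1, h2, h3⟩

theorem pareto_eq_zero (h : MatrixAggregation 𝓜 Φ) {m : N → Matrix U U ℝ} (hm : ∀ i, m i ∈ 𝓜)
    {p q : U → ℝ} (hp : p ∈ stdSimplex ℝ U) (hq : q ∈ stdSimplex ℝ U)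
    (h0 : ∀ i, form (m i) p q = 0) : form (Φ m) p q = 0 := by
  apply le_antisymm
  · have := (h.pareto m hm q hq p hp fun i => by
      rw [form_skew (h.skew _ (hm i)), h0, neg_zero]).1
    rw [form_skew (h.social_skew m hm)] at this
    linarith
  · exact (h.pareto m hm p hp q hq fun i => (h0 i).ge).1

theorem pareto_pure (h : MatrixAggregation 𝓜 Φ) {m : N → Matrix U U ℝ} (hm : ∀ i, m i ∈ 𝓜)
    {x y : U} (h0 : ∀ i, 0 ≤ m i x y) {i : N} (hi : 0 < m i x y) : 0 < Φ m x y := by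
  have := (h.pareto m hm _ (single_mem_stdSimplex ℝ x) _ (single_mem_stdSimplex ℝ y)
    fun i => by rw [form_single]; exact h0 i).2 ⟨i, by rw [form_single]; exact hi⟩
  rwa [form_single] at this

theorem bottom_pos (h : MatrixAggregation 𝓜 Φ) [Nonempty N] {m : N → Matrix U U ℝ}
    (hm : ∀ i, m i ∈ 𝓜) {x b : U} (hx : ∀ i, m i x b = 1) : 0 < Φ m x b :=
  h.pareto_pure hm (fun i => by rw [hx]; norm_num) (i := Classical.arbitrary N)
    (by rw [hx]; norm_num)

/-- Alternatives that everyone prefers to `b` are socially preferred to `b` with the same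
intensity. -/
theorem bottom_eq (h : MatrixAggregation 𝓜 Φ) (hU : 5 ≤ Fintype.card U)
    {m : N → Matrix U U ℝ} (hm : ∀ i, m i ∈ 𝓜) {x y b : U} (hx : ∀ i, m i x b = 1)
    (hy : ∀ i, m i y b = 1) : Φ m x b = Φ m y b := by
  have hcard : ({x, y, b} : Finset U).card ≤ 4 := Finset.card_le_three.trans (by norm_num)
  obtain ⟨c, hc⟩ := exists_fresh hU hcard
  obtain ⟨m', hm', hag, hbot⟩ := h.bottom_profile hm hcard hc
  -- With `c` below everything, everyone is indifferent between `b` and an even lottery over `z` and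
  -- `c`. Society agrees, so the intensity of `z` over `b` equals that of `b` over `c`, whatever `z`
  -- is.
  have key : ∀ z ∈ ({x, y, b} : Finset U), (∀ i, m i z b = 1) → Φ m' z b = Φ m' b c := by
    intro z hz hzb
    have := h.pareto_eq_zero hm' (single_mem_stdSimplex ℝ b)
      (mix_two_mem (α := 1 / 2) (β := 1 / 2) (by norm_num) (by norm_num) (by norm_num) z c)
      fun i => by
        simp only [map_add, map_smul, form_single, smul_eq_mul]
        rw [h.skew _ (hm' i) b z, hag i z hz b (by simp), hzb, hbot i b (by simp)]
        norm_num
    simp only [map_add, map_smul, form_single, smul_eq_mul] at this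
    rw [h.social_skew m' hm' b z] at this
    linarith
  obtain ⟨k, hk, hkk⟩ := h.iia m m' hm hm' {x, y, b} fun i s hs t ht => (hag i s hs t ht).symm
  rw [hkk x (by simp) b (by simp), hkk y (by simp) b (by simp), key x (by simp) hx,
    key y (by simp) hy]

theorem ne_of_bottom (h : MatrixAggregation 𝓜 Φ) [Nonempty N] {m : N → Matrix U U ℝ}
    (hm : ∀ i, m i ∈ 𝓜) {x b : U} (hx : ∀ i, m i x b = 1) : x ≠ b := by
  rintro rfl
  have := hx (Classical.arbitrary N)
  rw [h.diag (hm _)] at this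
  norm_num at this

theorem Fits.symm (h : MatrixAggregation 𝓜 Φ) {m : N → Matrix U U ℝ} {v : N → ℝ} {x y b : U}
    (hf : Fits 𝓜 m v x y b) : Fits 𝓜 m (-v) y x b :=
  ⟨hf.mem, fun i => by rw [h.skew _ (hf.mem i), hf.pair, Pi.neg_apply], hf.right, hf.left⟩

theorem ratio_symm (h : MatrixAggregation 𝓜 Φ) (hU : 5 ≤ Fintype.card U)
    {m : N → Matrix U U ℝ} {v : N → ℝ} {x y b : U} (hf : Fits 𝓜 m v x y b) :
    Φ m y x / Φ m y b = -(Φ m x y / Φ m x b) := by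
  rw [h.bottom_eq hU hf.mem hf.right hf.left, h.social_skew m hf.mem y x, neg_div]

theorem exists_pair (h : MatrixAggregation 𝓜 Φ) {X : Finset U} (hX : X.card ≤ 4) {y : U}
    (hy : y ∉ X) {v : ℝ} (hv : v = -1 ∨ v = 0 ∨ v = 1) :
    ∃ A ∈ 𝓜, (∀ x ∈ X, ∀ x' ∈ X, A x x' = 0) ∧ ∀ x ∈ X, A x y = v := by
  rcases hv with rfl | rfl | rfl
  · obtain ⟨A, hA, h1, h2⟩ := h.top h.zero_mem hX hy
    exact ⟨A, hA, h1, fun x hx => by rw [h.skew A hA, h2 x hx]⟩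
  · exact ⟨0, h.zero_mem, fun _ _ _ _ => rfl, fun _ _ => rfl⟩
  · obtain ⟨A, hA, h1, h2⟩ := h.bottom 0 h.zero_mem X hX y hy
    exact ⟨A, hA, h1, h2⟩

theorem exists_fits_two (h : MatrixAggregation 𝓜 Φ) {v : N → ℝ}
    (hv : ∀ i, v i = -1 ∨ v i = 0 ∨ v i = 1) {x z y b : U} (hxy : x ≠ y) (hzy : z ≠ y)
    (hb : b ∉ ({x, z, y} : Finset U)) :
    ∃ m : N → Matrix U U ℝ, Fits 𝓜 m v x y b ∧ Fits 𝓜 m v z y b ∧ ∀ i, m i x z = 0 := by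
  choose A hA h1 h2 using fun i => h.exists_pair (X := {x, z})
    (Finset.card_le_two.trans (by norm_num)) (y := y)
    (by simp only [Finset.mem_insert, Finset.mem_singleton]; tauto) (hv i)
  obtain ⟨m, hm, hag, hbot⟩ := h.bottom_profile (X := {x, z, y}) hA
    (Finset.card_le_three.trans (by norm_num)) hb
  refine ⟨m, ⟨hm, fun i => ?_, fun i => hbot i x (by simp), fun i => hbot i y (by simp)⟩,
    ⟨hm, fun i => ?_, fun i => hbot i z (by simp), fun i => hbot i y (by simp)⟩, fun i => ?_⟩
  · rw [hag i x (by simp) y (by simp), h2 i x (by simp)]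
  · rw [hag i z (by simp) y (by simp), h2 i z (by simp)]
  · rw [hag i x (by simp) z (by simp), h1 i x (by simp) z (by simp)]

theorem exists_fits (h : MatrixAggregation 𝓜 Φ) (hU : 5 ≤ Fintype.card U) {v : N → ℝ}
    (hv : ∀ i, v i = -1 ∨ v i = 0 ∨ v i = 1) {x y : U} (hxy : x ≠ y) :
    ∃ (m : N → Matrix U U ℝ) (b : U), Fits 𝓜 m v x y b := by
  obtain ⟨b, hb⟩ := exists_fresh hU (X := {x, x, y}) (Finset.card_le_three.trans (by norm_num))
  obtain ⟨m, hm, -⟩ := h.exists_fits_two hv hxy hxy hb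
  exact ⟨m, b, hm⟩

/-- The profile on the triple is determined by `v`, so IIA fixes the social matrix there up to a
factor, which the quotient cancels. -/
theorem ratio_same_triple (h : MatrixAggregation 𝓜 Φ) {m m' : N → Matrix U U ℝ} {v : N → ℝ}
    {x y b : U} (hf : Fits 𝓜 m v x y b) (hf' : Fits 𝓜 m' v x y b) :
    Φ m x y / Φ m x b = Φ m' x y / Φ m' x b := by
  obtain ⟨k, hk, hkk⟩ := h.iia m m' hf.mem hf'.mem {x, y, b} fun i =>
    agree_triple (h.skew _ (hf.mem i)) (h.skew _ (hf'.mem i)) (by rw [hf.pair, hf'.pair])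
      (by rw [hf.left, hf'.left]) (by rw [hf.right, hf'.right])
  rw [hkk x (by simp) y (by simp), hkk x (by simp) b (by simp), mul_div_mul_left _ _ hk.ne']

/-- The new worst alternative `c` is put below `x`, `y` and `b` in an auxiliary profile. The
lotteries `x/2 + b/2` and `2x/3 + c/3` are then unanimously indifferent, which equates the
intensities of `x` over `b` and over `c`. -/
theorem ratio_change_bottom (h : MatrixAggregation 𝓜 Φ) [Nonempty N] (hU : 5 ≤ Fintype.card U)
    {m m' : N → Matrix U U ℝ} {v : N → ℝ} {x y b c : U} (hf : Fits 𝓜 m v x y b)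
    (hf' : Fits 𝓜 m' v x y c) : Φ m x y / Φ m x b = Φ m' x y / Φ m' x c := by
  by_cases hbc : c = b
  · subst hbc; exact h.ratio_same_triple hf hf'
  have hc : c ∉ ({x, y, b} : Finset U) := by
    have := (h.ne_of_bottom hf'.mem hf'.left).symm
    have := (h.ne_of_bottom hf'.mem hf'.right).symm
    simp only [Finset.mem_insert, Finset.mem_singleton]; tauto
  obtain ⟨n, hn, hag, hbot⟩ := h.bottom_profile (X := {x, y, b}) hf.mem
    (Finset.card_le_three.trans (by norm_num)) hc
  have hb : Fits 𝓜 n v x y b :=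
    ⟨hn, fun i => by rw [hag i x (by simp) y (by simp), hf.pair],
      fun i => by rw [hag i x (by simp) b (by simp), hf.left],
      fun i => by rw [hag i y (by simp) b (by simp), hf.right]⟩
  have hc : Fits 𝓜 n v x y c :=
    ⟨hn, hb.pair, fun i => hbot i x (by simp), fun i => hbot i y (by simp)⟩
  have hbc1 : ∀ i, n i b c = 1 := fun i => hbot i b (by simp)
  have hbx : ∀ i, n i b x = -1 := fun i => by rw [h.skew _ (hn i), hb.left]
  have hp := h.pareto_eq_zero hn
    (mix_two_mem (α := 1 / 2) (β := 1 / 2) (by norm_num) (by norm_num) (by norm_num) x b)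
    (mix_two_mem (α := 2 / 3) (β := 1 / 3) (by norm_num) (by norm_num) (by norm_num) x c)
    fun i => by
      simp only [map_add, map_smul, LinearMap.add_apply, LinearMap.smul_apply, form_single,
        smul_eq_mul, h.diag (hn i), hbx, hbc1, hc.left]
      norm_num
  simp only [map_add, map_smul, LinearMap.add_apply, LinearMap.smul_apply, form_single,
    smul_eq_mul, h.social_diag hn, h.social_skew n hn b x, h.bottom_eq hU hn hbc1 hc.left] at hp
  have : Φ n x b = Φ n x c := by linarith
  rw [h.ratio_same_triple hf hb, ← h.ratio_same_triple hc hf', this]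

/-- In a profile where everyone is indifferent between `x` and `z` and compares both with `y`
according to `v`, the even lotteries over `x`, `y` and over `z`, `y` are unanimously indifferent. -/
theorem ratio_change_left (h : MatrixAggregation 𝓜 Φ) [Nonempty N] (hU : 5 ≤ Fintype.card U)
    {m m' : N → Matrix U U ℝ} {v : N → ℝ} {x z y b b' : U} (hxy : x ≠ y) (hzy : z ≠ y)
    (hf : Fits 𝓜 m v x y b) (hf' : Fits 𝓜 m' v z y b') :
    Φ m x y / Φ m x b = Φ m' z y / Φ m' z b' := by
  have hv : ∀ i, v i = -1 ∨ v i = 0 ∨ v i = 1 := fun i => by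
    rw [← hf.pair i]; exact h.values _ (hf.mem i) _ _
  obtain ⟨c, hc⟩ := exists_fresh hU (X := {x, z, y}) (Finset.card_le_three.trans (by norm_num))
  obtain ⟨n, hn1, hn2, hxz⟩ := h.exists_fits_two hv hxy hzy hc
  rw [h.ratio_change_bottom hU hf hn1, ← h.ratio_change_bottom hU hn2 hf',
    h.bottom_eq hU hn1.mem hn1.left hn2.left]
  congr 1
  have hp1 := h.pareto_eq_zero hn1.mem (single_mem_stdSimplex ℝ x) (single_mem_stdSimplex ℝ z)
    fun i => by rw [form_single, hxz]
  rw [form_single] at hp1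
  have hyz : ∀ i, n i y z = -v i := fun i => by rw [h.skew _ (hn1.mem i), hn2.pair]
  have hp2 := h.pareto_eq_zero hn1.mem
    (mix_two_mem (α := 1 / 2) (β := 1 / 2) (by norm_num) (by norm_num) (by norm_num) x y)
    (mix_two_mem (α := 1 / 2) (β := 1 / 2) (by norm_num) (by norm_num) (by norm_num) z y)
    fun i => by
      simp only [map_add, map_smul, LinearMap.add_apply, LinearMap.smul_apply, form_single,
        smul_eq_mul, h.diag (hn1.mem i), hxz, hn1.pair, hyz]
      ring
  simp only [map_add, map_smul, LinearMap.add_apply, LinearMap.smul_apply, form_single,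
    smul_eq_mul, h.social_diag hn1.mem, hp1, h.social_skew n hn1.mem y z] at hp2
  linarith

theorem ratio_change_right (h : MatrixAggregation 𝓜 Φ) [Nonempty N] (hU : 5 ≤ Fintype.card U)
    {m m' : N → Matrix U U ℝ} {v : N → ℝ} {x z y b b' : U} (hxy : x ≠ y) (hxz : x ≠ z)
    (hf : Fits 𝓜 m v x y b) (hf' : Fits 𝓜 m' v x z b') :
    Φ m x y / Φ m x b = Φ m' x z / Φ m' x b' := by
  have := h.ratio_change_left hU hxy.symm hxz.symm (Fits.symm h hf) (Fits.symm h hf')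
  rw [h.ratio_symm hU hf, h.ratio_symm hU hf'] at this
  linarith

/-- The alternatives are replaced one at a time, through some `z` different from `y` and `y'` so
that no intermediate pair degenerates. -/
theorem ratio_neutral (h : MatrixAggregation 𝓜 Φ) [Nonempty N] (hU : 5 ≤ Fintype.card U)
    {m m' : N → Matrix U U ℝ} {v : N → ℝ} {x y b x' y' b' : U} (hxy : x ≠ y) (hxy' : x' ≠ y')
    (hf : Fits 𝓜 m v x y b) (hf' : Fits 𝓜 m' v x' y' b') :
    Φ m x y / Φ m x b = Φ m' x' y' / Φ m' x' b' := by
  have hv : ∀ i, v i = -1 ∨ v i = 0 ∨ v i = 1 := fun i => by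
    rw [← hf.pair i]; exact h.values _ (hf.mem i) _ _
  obtain ⟨z, hz⟩ := exists_fresh hU (X := {y, y'}) (Finset.card_le_two.trans (by norm_num))
  simp only [Finset.mem_insert, Finset.mem_singleton, not_or] at hz
  obtain ⟨n, c, hn⟩ := h.exists_fits hU hv hz.1
  obtain ⟨n', c', hn'⟩ := h.exists_fits hU hv hz.2
  rw [h.ratio_change_left hU hxy hz.1 hf hn, h.ratio_change_right hU hz.1 hz.2 hn hn',
    h.ratio_change_left hU hz.2 hxy' hn' hf']

/-- The social comparison of two alternatives is a function of the individual comparisons,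
relative to an alternative that everyone puts below both. -/
theorem exists_comparison (h : MatrixAggregation 𝓜 Φ) [Nonempty N] (hU : 5 ≤ Fintype.card U) :
    ∃ g : (N → ℝ) → ℝ, ∀ (m : N → Matrix U U ℝ) (v : N → ℝ) (x y b : U), x ≠ y →
      Fits 𝓜 m v x y b → Φ m x y = g v * Φ m x b := by
  have hex : ∀ v : N → ℝ, ∃ g : ℝ, ∀ (m : N → Matrix U U ℝ) (x y b : U), x ≠ y →
      Fits 𝓜 m v x y b → Φ m x y = g * Φ m x b := by
    intro v
    by_cases hv : ∃ (m : N → Matrix U U ℝ) (x y b : U), x ≠ y ∧ Fits 𝓜 m v x y b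
    · obtain ⟨m, x, y, b, hxy, hf⟩ := hv
      refine ⟨Φ m x y / Φ m x b, fun m' x' y' b' hxy' hf' => ?_⟩
      rw [h.ratio_neutral hU hxy hxy' hf hf',
        div_mul_cancel₀ _ (h.bottom_pos hf'.mem hf'.left).ne']
    · push Not at hv
      exact ⟨0, fun m x y b hxy hf => absurd hf (hv m x y b hxy)⟩
  choose g hg using hex
  exact ⟨g, fun m v x y b hxy hf => hg v m x y b hxy hf⟩

end MatrixAggregation

end MatrixAggregation

/-! ### Linearity of the comparison function and the weights. -/

section Additivity

variable {U : Type*} [Fintype U] [DecidableEq U] {N : Type*}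
  {𝓜 : Set (Matrix U U ℝ)} {Φ : (N → Matrix U U ℝ) → Matrix U U ℝ}

/-- The function `g` gives the social comparison of two alternatives in terms of the individual
comparisons. -/
def IsComparison (𝓜 : Set (Matrix U U ℝ)) (Φ : (N → Matrix U U ℝ) → Matrix U U ℝ)
    (g : (N → ℝ) → ℝ) : Prop :=
  ∀ (m : N → Matrix U U ℝ) (v : N → ℝ) (x y b : U), x ≠ y →
    Fits 𝓜 m v x y b → Φ m x y = g v * Φ m x b

namespace MatrixAggregation

variable {g : (N → ℝ) → ℝ}

theorem comparison_neg (h : MatrixAggregation 𝓜 Φ) [Nonempty N] (hU : 5 ≤ Fintype.card U)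
    (hg : IsComparison 𝓜 Φ g) {v : N → ℝ} (hv : ∀ i, v i = -1 ∨ v i = 0 ∨ v i = 1) :
    g (-v) = -g v := by
  have : Nontrivial U := Fintype.one_lt_card_iff_nontrivial.1 (by omega)
  obtain ⟨x, y, hxy⟩ := exists_pair_ne U
  obtain ⟨m, b, hf⟩ := h.exists_fits hU hv hxy
  have h1 := hg m v x y b hxy hf
  have h2 := hg m (-v) y x b hxy.symm (Fits.symm h hf)
  have hpos := h.bottom_pos hf.mem hf.left
  rw [h.social_skew m hf.mem y x, h1, h.bottom_eq hU hf.mem hf.right hf.left] at h2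
  apply mul_right_cancel₀ hpos.ne'
  linarith

theorem comparison_pos (h : MatrixAggregation 𝓜 Φ) [Nonempty N] (hU : 5 ≤ Fintype.card U)
    (hg : IsComparison 𝓜 Φ g) {v : N → ℝ} (hv : ∀ i, v i = 0 ∨ v i = 1) {i : N}
    (hi : v i = 1) : 0 < g v := by
  have : Nontrivial U := Fintype.one_lt_card_iff_nontrivial.1 (by omega)
  obtain ⟨x, y, hxy⟩ := exists_pair_ne U
  obtain ⟨m, b, hf⟩ := h.exists_fits hU (fun i => Or.inr (hv i)) hxy
  have h1 := hg m v x y b hxy hf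
  have h2 := h.bottom_pos hf.mem hf.left
  have h3 : 0 < Φ m x y := h.pareto_pure hf.mem
    (fun j => by rw [hf.pair]; rcases hv j with h | h <;> rw [h]; norm_num) (i := i)
    (by rw [hf.pair, hi]; norm_num)
  rw [h1] at h3
  exact pos_of_mul_pos_left h3 h2.le

/-- With a common worst alternative, the social comparisons are given by `g` up to scale. -/
theorem exists_scaled (h : MatrixAggregation 𝓜 Φ) [Nonempty N] (hU : 5 ≤ Fintype.card U)
    (hg : IsComparison 𝓜 Φ g) {m : N → Matrix U U ℝ} (hm : ∀ i, m i ∈ 𝓜) {X : Finset U}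
    (hX : X.card ≤ 4) : ∃ (m' : N → Matrix U U ℝ) (b : U) (c : ℝ), 0 < c ∧ (∀ i, m' i ∈ 𝓜) ∧
      (∀ i, ∀ x ∈ X, ∀ y ∈ X, m' i x y = m i x y) ∧ (∀ i, ∀ x ∈ X, m' i x b = 1) ∧
      (∀ x ∈ X, Φ m' x b = c) ∧
      ∀ x ∈ X, ∀ y ∈ X, x ≠ y → Φ m' x y = g (fun i => m i x y) * c := by
  obtain ⟨b, hb⟩ := exists_fresh hU hX
  obtain ⟨m', hm', hag, hbot⟩ := h.bottom_profile hm hX hb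
  rcases X.eq_empty_or_nonempty with rfl | ⟨z, hz⟩
  · exact ⟨m', b, 1, one_pos, hm', hag, hbot, by simp, by simp⟩
  · have hc : ∀ x ∈ X, Φ m' x b = Φ m' z b := fun x hx =>
      h.bottom_eq hU hm' (fun i => hbot i x hx) (fun i => hbot i z hz)
    refine ⟨m', b, Φ m' z b, h.bottom_pos hm' fun i => hbot i z hz, hm', hag, hbot, hc,
      fun x hx y hy hxy => ?_⟩
    rw [hg m' (fun i => m i x y) x y b hxy ⟨hm', fun i => hag i x hx y hy,
      fun i => hbot i x hx, fun i => hbot i y hy⟩, hc x hx]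

/-- Linear relations between individual comparisons of two alternatives with two alternatives
carry over to `g`. -/
theorem comparison_relation (h : MatrixAggregation 𝓜 Φ) [Nonempty N] (hU : 5 ≤ Fintype.card U)
    (hg : IsComparison 𝓜 Φ g) {m : N → Matrix U U ℝ} (hm : ∀ i, m i ∈ 𝓜) {x y z w : U}
    (hxz : x ≠ z) (hxw : x ≠ w) (hyz : y ≠ z) (hyw : y ≠ w) {α β γ δ ε : ℝ} (hα : 0 ≤ α)
    (hβ : 0 ≤ β) (hγ : 0 ≤ γ) (hδ : 0 ≤ δ) (hε : 0 ≤ ε) (h1 : α + β + γ = 1) (h2 : δ + ε = 1)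
    (hrel : ∀ i, α * (δ * m i x z + ε * m i x w) + β * (δ * m i y z + ε * m i y w) = γ) :
    α * (δ * g (fun i => m i x z) + ε * g (fun i => m i x w)) +
      β * (δ * g (fun i => m i y z) + ε * g (fun i => m i y w)) = γ := by
  obtain ⟨m', b, c, hc, hm', hag, hbot, hΦb, hΦ⟩ := h.exists_scaled hU hg hm (X := {x, y, z, w})
    Finset.card_le_four
  have hbz : ∀ i, m' i b z = -1 := fun i => by rw [h.skew _ (hm' i), hbot i z (by simp)]
  have hbw : ∀ i, m' i b w = -1 := fun i => by rw [h.skew _ (hm' i), hbot i w (by simp)]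
  -- The assumed relation states that everyone is indifferent between the lotteries with weights `α,
  -- β, γ` on `x, y, b` and `δ, ε` on `z, w`; the common worst alternative `b` contributes the
  -- constant `-γ`.
  have hp := h.pareto_eq_zero hm' (mix_three_mem hα hβ hγ h1 x y b) (mix_two_mem hδ hε h2 z w)
    fun i => by
      simp only [map_add, map_smul, LinearMap.add_apply, LinearMap.smul_apply, form_single,
        smul_eq_mul, hbz, hbw]
      rw [hag i x (by simp) z (by simp), hag i x (by simp) w (by simp), hag i y (by simp) z
        (by simp), hag i y (by simp) w (by simp)]
      linear_combination hrel i - γ * h2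
  simp only [map_add, map_smul, LinearMap.add_apply, LinearMap.smul_apply, form_single,
    smul_eq_mul] at hp
  rw [h.social_skew m' hm' b z, h.social_skew m' hm' b w, hΦb z (by simp), hΦb w (by simp),
    hΦ x (by simp) z (by simp) hxz, hΦ x (by simp) w (by simp) hxw, hΦ y (by simp) z (by simp) hyz,
    hΦ y (by simp) w (by simp) hyw] at hp
  apply mul_right_cancel₀ hc.ne'
  linear_combination hp + γ * c * h2

theorem exists_first_above_tie (h : MatrixAggregation 𝓜 Φ) {x y z : U} (hxy : x ≠ y)
    (hxz : x ≠ z) : ∃ A ∈ 𝓜, A x y = 1 ∧ A x z = 1 ∧ A y z = 0 ∧ A z y = 0 := by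
  obtain ⟨A, hA, h1, h2⟩ := h.top h.zero_mem (X := {y, z}) (b := x)
    (Finset.card_le_two.trans (by norm_num)) (by simp [hxy, hxz])
  exact ⟨A, hA, h2 y (by simp), h2 z (by simp), h1 y (by simp) z (by simp),
    h1 z (by simp) y (by simp)⟩

theorem exists_chain (h : MatrixAggregation 𝓜 Φ) {x y z w : U} (hxy : x ≠ y) (hxz : x ≠ z)
    (hxw : x ≠ w) (hyz : y ≠ z) (hyw : y ≠ w) :
    ∃ A ∈ 𝓜, A x y = 1 ∧ A x z = 1 ∧ A x w = 1 ∧ A y z = 1 ∧ A y w = 1 ∧ A z w = 0 := by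
  obtain ⟨A, hA, h1, h2, h3, -⟩ := h.exists_first_above_tie hyz hyw
  obtain ⟨A', hA', h4, h5⟩ := h.top hA (X := {y, z, w}) (b := x)
    (Finset.card_le_three.trans (by norm_num)) (by simp [hxy, hxz, hxw])
  exact ⟨A', hA', h5 y (by simp), h5 z (by simp), h5 w (by simp),
    by rw [h4 y (by simp) z (by simp), h1], by rw [h4 y (by simp) w (by simp), h2],
    by rw [h4 z (by simp) w (by simp), h3]⟩

theorem exists_four (hU : 5 ≤ Fintype.card U) : ∃ x y z w : U,
    x ≠ y ∧ x ≠ z ∧ x ≠ w ∧ y ≠ z ∧ y ≠ w ∧ z ≠ w := by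
  obtain ⟨x, -⟩ := exists_fresh hU (X := ∅) (by simp)
  obtain ⟨y, hy⟩ := exists_fresh hU (X := {x}) (by simp)
  obtain ⟨z, hz⟩ := exists_fresh hU (X := {x, y}) (Finset.card_le_two.trans (by norm_num))
  obtain ⟨w, hw⟩ := exists_fresh hU (X := {x, y, z}) (Finset.card_le_three.trans (by norm_num))
  simp only [Finset.mem_insert, Finset.mem_singleton, not_or] at hy hz hw
  exact ⟨x, y, z, w, Ne.symm hy, Ne.symm hz.1, Ne.symm hw.1, Ne.symm hz.2, Ne.symm hw.2.1,
    Ne.symm hw.2.2⟩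

/-- Agents in `P` put `x` above tied `y` and `z`, the others put `z` above tied `x` and `y`. For
everyone, the comparisons of `x` with `y` and of `z` with `y` sum to one. -/
theorem comparison_compl (h : MatrixAggregation 𝓜 Φ) [Nonempty N] (hU : 5 ≤ Fintype.card U)
    (hg : IsComparison 𝓜 Φ g) (P : N → Prop) [DecidablePred P] :
    g (fun i => if P i then 1 else 0) + g (fun i => if P i then 0 else 1) = 1 := by
  obtain ⟨x, y, z, w, hxy, hxz, -, hyz, -, -⟩ := exists_four hU
  have hex : ∀ i, ∃ A ∈ 𝓜, A x y = (if P i then 1 else 0) ∧ A z y = if P i then 0 else 1 := by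
    intro i
    by_cases hi : P i
    · obtain ⟨A, hA, h1, -, -, h2⟩ := h.exists_first_above_tie hxy hxz
      exact ⟨A, hA, by simp [hi, h1], by simp [hi, h2]⟩
    · obtain ⟨A, hA, -, h1, h2, -⟩ := h.exists_first_above_tie hxz.symm hyz.symm
      exact ⟨A, hA, by simp [hi, h2], by simp [hi, h1]⟩
  choose m hm h1 h2 using hex
  have := h.comparison_relation hU hg hm hxy hxy hyz.symm hyz.symm (α := 1 / 3) (β := 1 / 3)
    (γ := 1 / 3) (δ := 1) (ε := 0) (by norm_num) (by norm_num) (by norm_num) (by norm_num)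
    (by norm_num) (by norm_num) (by norm_num) fun i => by
      rw [h1, h2]; split_ifs <;> norm_num
  simp only [h1, h2] at this
  linarith

/-- Agents in `P` rank `x` over `y` over `z`, the others put `z` above tied `x` and `y`. Twice the
comparison of `x` with `y` plus that of `z` with `y` is one for everyone. -/
theorem comparison_sign (h : MatrixAggregation 𝓜 Φ) [Nonempty N] (hU : 5 ≤ Fintype.card U)
    (hg : IsComparison 𝓜 Φ g) (P : N → Prop) [DecidablePred P] :
    2 * g (fun i => if P i then 1 else 0) + g (fun i => if P i then -1 else 1) = 1 := by
  obtain ⟨x, y, z, w, hxy, hxz, hxw, hyz, hyw, hzw⟩ := exists_four hU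
  have hex : ∀ i, ∃ A ∈ 𝓜, A x y = (if P i then 1 else 0) ∧ A z y = if P i then -1 else 1 := by
    intro i
    by_cases hi : P i
    · obtain ⟨A, hA, h1, -, -, h2, -⟩ := h.exists_chain hxy hxz hxw hyz hyw
      exact ⟨A, hA, by simp [hi, h1], by simp [hi, h.skew A hA z y, h2]⟩
    · obtain ⟨A, hA, -, h1, h2, -⟩ := h.exists_first_above_tie hxz.symm hyz.symm
      exact ⟨A, hA, by simp [hi, h2], by simp [hi, h1]⟩
  choose m hm h1 h2 using hex
  have := h.comparison_relation hU hg hm hxy hxy hyz.symm hyz.symm (α := 1 / 2) (β := 1 / 4)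
    (γ := 1 / 4) (δ := 1) (ε := 0) (by norm_num) (by norm_num) (by norm_num) (by norm_num)
    (by norm_num) (by norm_num) (by norm_num) fun i => by
      rw [h1, h2]; split_ifs <;> norm_num
  simp only [h1, h2] at this
  linarith

/-- Depending on `v i`, the agent's ranking of four alternatives is chosen so that the comparisons
of `x` and `y` with `z` and `w` always sum to one, with `v i` as one of them. Of the other three,
one is an indicator and two are sign vectors, which `comparison_sign` reduces to indicators. -/
theorem comparison_eq (h : MatrixAggregation 𝓜 Φ) [Nonempty N] (hU : 5 ≤ Fintype.card U)
    (hg : IsComparison 𝓜 Φ g) {v : N → ℝ} (hv : ∀ i, v i = -1 ∨ v i = 0 ∨ v i = 1) :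
    g v = g (fun i => if v i = 0 then 1 else 0) + 2 * g (fun i => if v i = 1 then 1 else 0) - 1 := by
  obtain ⟨x, y, z, w, hxy, hxz, hxw, hyz, hyw, hzw⟩ := exists_four hU
  have hex : ∀ i, ∃ A ∈ 𝓜, A x z = (if v i = 0 then -1 else 1) ∧ A x w = v i ∧
      A y z = (if v i = 1 then -1 else 1) ∧ A y w = if v i = 0 then 1 else 0 := by
    intro i
    rcases hv i with hi | hi | hi <;> rw [hi]
    · obtain ⟨A, hA, h1, h2, h3, h4, h5, h6⟩ :=
        h.exists_chain hxz.symm hyz.symm hzw hxy hxw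
      refine ⟨-A, h.neg_mem A hA, ?_, ?_, ?_, ?_⟩
      · rw [Matrix.neg_apply, ← h.skew A hA, h1]; norm_num
      · rw [Matrix.neg_apply, h5]
      · rw [Matrix.neg_apply, ← h.skew A hA, h2]; norm_num
      · rw [Matrix.neg_apply, h6]; norm_num
    · obtain ⟨A, hA, h1, h2, h3, h4, h5, h6⟩ :=
        h.exists_chain hyz hxy.symm hyw hxz.symm hzw
      refine ⟨A, hA, ?_, ?_, ?_, ?_⟩
      · rw [h.skew A hA, h4]; norm_num
      · rw [h6]
      · rw [h1]; norm_num
      · rw [h3]; norm_num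
    · obtain ⟨A, hA, h1, h2, h3, h4, h5, h6⟩ :=
        h.exists_chain hxz hxy hxw hyz.symm hzw
      refine ⟨A, hA, ?_, ?_, ?_, ?_⟩
      · rw [h1]; norm_num
      · rw [h3]
      · rw [h.skew A hA, h4]; norm_num
      · rw [h6]; norm_num
  choose m hm h1 h2 h3 h4 using hex
  have := h.comparison_relation hU hg hm hxz hxw hyz hyw (α := 2 / 5) (β := 2 / 5)
    (γ := 1 / 5) (δ := 1 / 2) (ε := 1 / 2) (by norm_num) (by norm_num) (by norm_num) (by norm_num)
    (by norm_num) (by norm_num) (by norm_num) fun i => by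
      rw [h1, h2, h3, h4]
      rcases hv i with hi | hi | hi <;> rw [hi] <;> norm_num
  simp only [h1, h2, h3, h4] at this
  have h5 := h.comparison_sign hU hg (fun i => v i = 0)
  have h6 := h.comparison_sign hU hg (fun i => v i = 1)
  linarith

/-- Adding the formulas of `comparison_eq` for `v` and `-v` cancels the left sides because `g` is
odd; what remains is additivity on disjoint groups. -/
theorem comparison_union (h : MatrixAggregation 𝓜 Φ) [Nonempty N] (hU : 5 ≤ Fintype.card U)
    (hg : IsComparison 𝓜 Φ g) {v : N → ℝ} (hv : ∀ i, v i = -1 ∨ v i = 0 ∨ v i = 1) :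
    g (fun i => if v i = 1 then 1 else 0) + g (fun i => if v i = -1 then 1 else 0) =
      g (fun i => if v i = 0 then 0 else 1) := by
  have hv' : ∀ i, (-v) i = -1 ∨ (-v) i = 0 ∨ (-v) i = 1 := fun i => by
    rcases hv i with h | h | h <;> simp [h]
  have h1 := h.comparison_eq hU hg hv
  have h2 := h.comparison_eq hU hg hv'
  rw [h.comparison_neg hU hg hv] at h2
  simp only [Pi.neg_apply, neg_eq_iff_eq_neg, neg_zero] at h2
  have h3 := h.comparison_compl hU hg (fun i => v i = 0)
  linarith

/-- The comparison function is linear. -/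
theorem comparison_linear (h : MatrixAggregation 𝓜 Φ) [Nonempty N] [Fintype N]
    (hU : 5 ≤ Fintype.card U) (hg : IsComparison 𝓜 Φ g) [DecidableEq N] {v : N → ℝ}
    (hv : ∀ i, v i = -1 ∨ v i = 0 ∨ v i = 1) :
    g v = ∑ i, g (fun j => if j = i then 1 else 0) * v i := by
  have hdisj : ∀ S T : Finset N, Disjoint S T →
      g (fun i => if i ∈ S then 1 else 0) + g (fun i => if i ∈ T then 1 else 0) =
        g (fun i => if i ∈ S ∪ T then 1 else 0) := by
    intro S T hST
    -- A disjoint pair of groups is encoded as one sign vector: positive on `S`, negative on `T`.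
    have := h.comparison_union hU hg
      (v := fun i => if i ∈ S then 1 else if i ∈ T then -1 else 0)
      (fun i => by split_ifs <;> simp)
    have e1 : ∀ i, ((if i ∈ S then (1 : ℝ) else if i ∈ T then -1 else 0) = 1) ↔ i ∈ S := by
      intro i; by_cases hS : i ∈ S <;> by_cases hT : i ∈ T <;> simp [hS, hT]; norm_num
    have e2 : ∀ i, ((if i ∈ S then (1 : ℝ) else if i ∈ T then -1 else 0) = -1) ↔ i ∈ T := by
      intro i
      by_cases hS : i ∈ S
      · have := Finset.disjoint_left.1 hST hS
        simp only [hS, this, if_true, iff_false]; norm_num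
      · by_cases hT : i ∈ T <;> simp [hS, hT]
    have e3 : ∀ i, ((if i ∈ S then (1 : ℝ) else if i ∈ T then -1 else 0) = 0) ↔ ¬ i ∈ S ∪ T := by
      intro i
      rw [Finset.mem_union]
      by_cases hS : i ∈ S <;> by_cases hT : i ∈ T <;> simp [hS, hT]
    simp only [e1, e2, e3, ite_not] at this
    exact this
  have hempty : g (fun i => if i ∈ (∅ : Finset N) then 1 else 0) = 0 := by
    have := hdisj ∅ ∅ (Finset.disjoint_empty_left _)
    rw [Finset.empty_union] at this
    linarith
  have hsum : ∀ S : Finset N, g (fun i => if i ∈ S then 1 else 0) =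
      ∑ i ∈ S, g (fun j => if j = i then 1 else 0) := by
    intro S
    induction S using Finset.induction_on with
    | empty => rw [hempty, Finset.sum_empty]
    | insert a S ha ih =>
      rw [Finset.sum_insert ha, ← ih, Finset.insert_eq,
        ← hdisj {a} S (Finset.disjoint_singleton_left.2 ha)]
      simp only [Finset.mem_singleton]
  have hS : ∀ P : N → Prop, ∀ [DecidablePred P], g (fun i => if P i then 1 else 0) =
      ∑ i, if P i then g (fun j => if j = i then 1 else 0) else 0 := by
    intro P _
    have := hsum (Finset.univ.filter P)
    simp only [Finset.mem_filter, Finset.mem_univ, true_and, Finset.sum_filter] at this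
    exact this
  have h1 := h.comparison_eq hU hg hv
  have h2 := h.comparison_union hU hg hv
  have h3 := h.comparison_compl hU hg (fun i => v i = 0)
  have h4 : g v = g (fun i => if v i = 1 then 1 else 0) - g (fun i => if v i = -1 then 1 else 0) := by
    linarith
  rw [h4, hS, hS, ← Finset.sum_sub_distrib]
  refine Finset.sum_congr rfl fun i _ => ?_
  rcases hv i with hi | hi | hi <;> rw [hi] <;> norm_num

/-- Matrix aggregation is affine utilitarian. -/
theorem exists_weights (h : MatrixAggregation 𝓜 Φ) [Nonempty N] [Fintype N]
    (hU : 5 ≤ Fintype.card U) : ∃ w : N → ℝ, (∀ i, 0 < w i) ∧ ∀ m : N → Matrix U U ℝ,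
      (∀ i, m i ∈ 𝓜) → ∃ c : ℝ, 0 < c ∧ ∀ x y, Φ m x y = c * ∑ i, w i * m i x y := by
  classical
  obtain ⟨g, hg⟩ := h.exists_comparison hU
  refine ⟨fun i => g (fun j => if j = i then 1 else 0), fun i => ?_, fun m hm => ?_⟩
  · exact h.comparison_pos hU hg (fun j => by split_ifs <;> simp) (i := i) (by simp)
  set S : U → U → ℝ := fun x y => ∑ i, g (fun j => if j = i then 1 else 0) * m i x y with hS
  have hlocal : ∀ X : Finset U, X.card ≤ 4 →
      ∃ c : ℝ, 0 < c ∧ ∀ x ∈ X, ∀ y ∈ X, Φ m x y = c * S x y := by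
    intro X hX
    obtain ⟨m', b, c, hc, hm', hag, -, -, hΦ⟩ := h.exists_scaled hU hg hm hX
    obtain ⟨k, hk, hkk⟩ := h.iia m m' hm hm' X fun i x hx y hy => (hag i x hx y hy).symm
    refine ⟨k * c, mul_pos hk hc, fun x hx y hy => ?_⟩
    by_cases hxy : x = y
    · subst hxy
      rw [h.social_diag hm, hS]
      simp [h.diag (hm _)]
    · rw [hkk x hx y hy, hΦ x hx y hy hxy,
        h.comparison_linear hU hg fun i => h.values _ (hm i) x y]
      ring
  by_cases hne : ∃ x₀ y₀, S x₀ y₀ ≠ 0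
  · obtain ⟨x₀, y₀, hxy⟩ := hne
    obtain ⟨c, hc, hcc⟩ := hlocal {x₀, y₀} (Finset.card_le_two.trans (by norm_num))
    refine ⟨c, hc, fun x y => ?_⟩
    -- The factor on any four-element set containing the reference pair is determined by the nonzero
    -- value there, so it is always `c`.
    obtain ⟨d, hd, hdd⟩ := hlocal {x₀, y₀, x, y} Finset.card_le_four
    have h1 := hcc x₀ (by simp) y₀ (by simp)
    rw [hdd x₀ (by simp) y₀ (by simp)] at h1
    rw [← mul_right_cancel₀ hxy h1]
    exact hdd x (by simp) y (by simp)
  · push Not at hne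
    refine ⟨1, one_pos, fun x y => ?_⟩
    obtain ⟨d, hd, hdd⟩ := hlocal {x, y} (Finset.card_le_two.trans (by norm_num))
    have h1 := hdd x (by simp) y (by simp)
    rw [hne] at h1
    change Φ m x y = 1 * S x y
    rw [h1, hne, mul_zero, mul_zero]

end MatrixAggregation

end Additivity

/-! ### From rich preference domains to matrix aggregation. -/

section Domain

theorem weakPref_iff {U : Type*} [Fintype U] {r : Pref U} (hr : AsymmPref r) (p q : Outcome U) :
    WeakPref r p q ↔ ¬ r q p := by
  have := hr p q
  unfold WeakPref Indiff
  tauto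

variable {U : Type*} [Fintype U] [DecidableEq U]

theorem prefMatrix_values (r : Pref U) (x y : U) :
    prefMatrix r x y = -1 ∨ prefMatrix r x y = 0 ∨ prefMatrix r x y = 1 := by
  unfold prefMatrix
  split_ifs <;> simp

theorem prefMatrix_congr {r r' : Pref U} {x y x' y' : U}
    (h1 : r (pureOutcome x) (pureOutcome y) ↔ r' (pureOutcome x') (pureOutcome y'))
    (h2 : r (pureOutcome y) (pureOutcome x) ↔ r' (pureOutcome y') (pureOutcome x')) :
    prefMatrix r x y = prefMatrix r' x' y' := by
  unfold prefMatrix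
  split_ifs <;> first | rfl | (exfalso; tauto)

theorem prefMatrix_of_rel {r : Pref U} {x y : U} (h : r (pureOutcome x) (pureOutcome y)) :
    prefMatrix r x y = 1 := if_pos h

theorem prefMatrix_inverse {r : Pref U} (hr : AsymmPref r) :
    prefMatrix (fun p q => r q p) = -prefMatrix r := by
  ext x y
  rw [Matrix.neg_apply, ← prefMatrix_skew hr y x]
  rfl

theorem permOutcome_pureOutcome (π : Equiv.Perm U) (a : U) :
    permOutcome π (pureOutcome a) = pureOutcome (π a) := by
  apply Subtype.ext
  ext x
  simp only [permOutcome, pureOutcome, Pi.single_apply, Equiv.symm_apply_eq]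

theorem permPref_pure (π : Equiv.Perm U) (r : Pref U) (x y : U) :
    permPref π r (pureOutcome x) (pureOutcome y) ↔
      r (pureOutcome (π.symm x)) (pureOutcome (π.symm y)) := by
  rw [permPref, permOutcome_pureOutcome, permOutcome_pureOutcome]

/-- Richness only provides some worst alternative `a`. Asymmetry keeps `a` outside `X`, so
exchanging it with `b` leaves all comparisons within `X` unchanged. -/
theorem IsRich.bottom_at {D : Set (Pref U)} (hD : IsRich D) {r' : Pref U} (hr' : r' ∈ D)
    {X : Finset U} (hX : X.card ≤ 4) {b : U} (hb : b ∉ X) : ∃ r ∈ D,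
      (∀ x ∈ X, ∀ y ∈ X, (r (pureOutcome x) (pureOutcome y) ↔
        r' (pureOutcome x) (pureOutcome y))) ∧ ∀ x ∈ X, r (pureOutcome x) (pureOutcome b) := by
  obtain ⟨r, hr, a, h1, h2⟩ := hD.bottom r' hr' X hX
  have ha : a ∉ X := fun ha => (hD.subset hr).1 _ _ (h2 a ha) (h2 a ha)
  have hs : ∀ x ∈ X, (Equiv.swap a b).symm x = x := fun x hx => by
    rw [Equiv.symm_swap]
    exact Equiv.swap_apply_of_ne_of_ne (fun e => ha (e ▸ hx)) (fun e => hb (e ▸ hx))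
  refine ⟨permPref (Equiv.swap a b) r, hD.neutral r hr _, fun x hx y hy => ?_, fun x hx => ?_⟩
  · rw [permPref_pure, hs x hx, hs y hy]; exact h1 x hx y hy
  · rw [permPref_pure, hs x hx, Equiv.symm_swap, Equiv.swap_apply_right]; exact h2 x hx

theorem form_eq_of_agree {A A' : Matrix U U ℝ} {X : Set U} (h : ∀ x ∈ X, ∀ y ∈ X, A x y = A' x y)
    {p q : U → ℝ} (hp : ∀ a, a ∉ X → p a = 0) (hq : ∀ a, a ∉ X → q a = 0) :
    form A p q = form A' p q := by
  rw [form_apply, form_apply]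
  refine Finset.sum_congr rfl fun x _ => Finset.sum_congr rfl fun y _ => ?_
  by_cases hx : x ∈ X
  · by_cases hy : y ∈ X
    · rw [h x hx y hy]
    · rw [hq y hy]; ring
  · rw [hp x hx]; ring

/-- Arrovian social welfare functions on rich domains of pairwise comparison preferences in terms
of matrices. -/
theorem exists_matrixAggregation {N : Type*} {D : Set (Pref U)} (hD : IsRich D)
    (hpc : D ⊆ pcPrefs U) {f : SWF N D} (hf : Arrovian f) :
    ∃ Φ : (N → Matrix U U ℝ) → Matrix U U ℝ, MatrixAggregation (prefMatrix '' D) Φ ∧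
      ∀ R : N → D, ∀ p q : Outcome U, (f R : Pref U) p q ↔
        0 < form (Φ fun i => prefMatrix (R i : Pref U)) p.1 q.1 := by
  -- A social matrix is chosen for each admissible matrix profile; the value zero at the other
  -- profiles plays no role.
  have hex : ∀ m : N → Matrix U U ℝ, ∃ A : Matrix U U ℝ, (∀ i, m i ∈ prefMatrix '' D) →
      (∀ x y, A x y = -A y x) ∧ ∃ R : N → D, (∀ i, prefMatrix (R i : Pref U) = m i) ∧
        ∀ p q : Outcome U, (f R : Pref U) p q ↔ 0 < form A p.1 q.1 := by
    intro m
    by_cases hm : ∀ i, m i ∈ prefMatrix '' D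
    · choose R hR hRm using hm
      obtain ⟨A, hA, hrep⟩ := exists_matrix_of_mem_allPrefs (f fun i => ⟨R i, hR i⟩).2
      exact ⟨A, fun _ => ⟨hA, fun i => ⟨R i, hR i⟩, hRm, hrep⟩⟩
    · exact ⟨0, fun h => absurd h hm⟩
  choose Φ hΦ using hex
  refine ⟨Φ, ⟨?_, ?_, ?_, ?_, ?_, ?_, ?_, ?_⟩, fun R p q => ?_⟩
  · rintro _ ⟨r, hr, rfl⟩
    exact prefMatrix_skew (hD.subset hr).1
  · rintro _ ⟨r, hr, rfl⟩
    exact prefMatrix_values r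
  · refine ⟨_, hD.indifference, ?_⟩
    ext x y
    simp [prefMatrix]
  · rintro _ ⟨r, hr, rfl⟩
    exact ⟨_, hD.inverse r hr, prefMatrix_inverse (hD.subset hr).1⟩
  · rintro _ ⟨r, hr, rfl⟩ X hX b hb
    obtain ⟨r', hr', h1, h2⟩ := hD.bottom_at hr hX hb
    exact ⟨_, ⟨r', hr', rfl⟩, fun x hx y hy => prefMatrix_congr (h1 x hx y hy) (h1 y hy x hx),
      fun x hx => prefMatrix_of_rel (h2 x hx)⟩
  · exact fun m hm => (hΦ m hm).1
  · intro m hm p hp q hq hpq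
    obtain ⟨hsk, R, hR, hrep⟩ := hΦ m hm
    have hrel : ∀ (i : N) (p q : Outcome U), (R i : Pref U) p q ↔ 0 < form (m i) p.1 q.1 :=
      fun i p q => by rw [← hR i]; exact rel_iff_form_prefMatrix (hpc (R i).2) p q
    have hmsk : ∀ i x y, m i x y = -m i y x := fun i => by
      rw [← hR i]; exact prefMatrix_skew (hD.subset (R i).2).1
    obtain ⟨h1, h2⟩ := hf.1 R ⟨p, hp⟩ ⟨q, hq⟩ fun i => by
      rw [weakPref_iff (hD.subset (R i).2).1, hrel, form_skew (hmsk i)]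
      simpa using hpq i
    rw [weakPref_iff (f R).2.1, hrep, form_skew hsk] at h1
    refine ⟨by simpa using h1, fun ⟨i, hi⟩ => ?_⟩
    exact (hrep ⟨p, hp⟩ ⟨q, hq⟩).1 (h2 ⟨i, (hrel i ⟨p, hp⟩ ⟨q, hq⟩).2 hi⟩)
  · intro m m' hm hm' X hag
    obtain ⟨hsk, R, hR, hrep⟩ := hΦ m hm
    obtain ⟨hsk', R', hR', hrep'⟩ := hΦ m' hm'
    refine exists_proportional_on hsk hsk' X fun p hp q hq => ?_
    rw [← hrep, ← hrep']
    refine hf.2 R R' X (fun i p hp q hq => ?_) p hp q hq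
    rw [rel_iff_form_prefMatrix (hpc (R i).2), rel_iff_form_prefMatrix (hpc (R' i).2), hR, hR',
      form_eq_of_agree (hag i) hp hq]
  · obtain ⟨-, R', hR', hrep⟩ := hΦ (fun i => prefMatrix (R i : Pref U)) fun i => ⟨_, (R i).2, rfl⟩
    -- On pairwise-comparison preferences the comparison matrix determines the relation, so the
    -- profile used to define `Φ` is the given one.
    have : R' = R := by
      funext i
      apply Subtype.ext
      funext p q
      rw [rel_iff_form_prefMatrix (hpc (R' i).2), rel_iff_form_prefMatrix (hpc (R i).2), hR']
    rw [← this] at hrep ⊢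
    exact hrep p q

theorem form_sum_smul {N : Type*} [Fintype N] {A : Matrix U U ℝ} {c : ℝ} {w : N → ℝ}
    {m : N → Matrix U U ℝ} (h : ∀ x y, A x y = c * ∑ i, w i * m i x y) (p q : U → ℝ) :
    form A p q = c * ∑ i, w i * form (m i) p q := by
  have hA : A = c • ∑ i, w i • m i := by
    ext x y
    simp [h, Matrix.sum_apply]
  rw [hA]
  simp [form]

end Domain

end ConvexAggregation

/-- Every Arrovian social welfare function on a rich domain of pairwise-comparison preferences
over at least five alternatives is affine utilitarian with positive weights. -/
theorem theorem2 {U : Type*} [Fintype U] [DecidableEq U] (hU : 5 ≤ Fintype.card U)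
    {N : Type*} [Fintype N] (hN : 2 ≤ Fintype.card N)
    (D : Set (ConvexAggregation.Pref U)) (hD : ConvexAggregation.IsRich D)
    (hpc : D ⊆ ConvexAggregation.pcPrefs U)
    (f : ConvexAggregation.SWF N D) (hf : ConvexAggregation.Arrovian f) :
    ∃ w : N → ℝ, (∀ i, 0 < w i) ∧ ConvexAggregation.AffineUtilitarianWith w f := by
  have : Nonempty N := Fintype.card_pos_iff.1 (by omega)
  obtain ⟨Φ, hΦ, hrep⟩ := ConvexAggregation.exists_matrixAggregation hD hpc hf
  obtain ⟨w, hw, hsum⟩ := hΦ.exists_weights hU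
  refine ⟨w, hw, fun R φ hφ p q => ?_⟩
  obtain ⟨c, hc, hcA⟩ := hsum (fun i => ConvexAggregation.prefMatrix (R i : ConvexAggregation.Pref U))
    fun i => ⟨_, (R i).2, rfl⟩
  rw [hrep, ConvexAggregation.form_sum_smul hcA, mul_pos_iff_of_pos_left hc]
  simp only [fun i => ConvexAggregation.normalized_eq_form_prefMatrix (hpc (R i).2) (hφ i).1
    (hφ i).2 p q]
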